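/- Let $\lambda\in\mathbb C$, let $S=\mathbb C[w,x,y,z]$, put $$f = x^2+y^3+wz^2+w^3y-\lambda wy^2-\lambda w^4,\qquad R=S/(f),\qquad u=y-\lambda w,$$ and let $$\Psi=\begin{pmatrix}x&y&z&-w\\-uy&x&uw&z\\-wz&-w^2&x&-y\\uw^2&-wz&uy&x\end{pmatrix},\qquad \Phi=\begin{pmatrix}x&-y&-z&w\\uy&x&-uw&-z\\wz&w^2&x&y\\-uw^2&wz&-uy&x\end{pmatrix}.$$ Then $\Phi\Psi=\Psi\Phi=f\cdot\mathbf 1$. Let $M=\operatorname{coker}(\Psi: R^4\to R^4)$. Let $Q$ be the quiver with two vertices $R$ and $M$, one arrow $d:R\to M$, one arrow $c:M\to R$ and two loops $a,b$ at $M$, and let $\mathbb CQ$ be its path algebra, paths being composed from right to left. Let $I\subset\mathbb CQ$ be the two-sided ideal generated by $$(b^2+dc)d,\qquad c(b^2+dc),\qquad ab+ba,\qquad a^2+bdc+dcb+\lambda b^2+b^3 .$$ (i) These four elements are, in this order, the cyclic derivatives $\partial W/\partial c$, $\partial W/\partial d$, $\partial W/\partial a$, $\partial W/\partial b$ of the superpotential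 $$W=b^2dc+\tfrac12\,dcdc+a^2b+\tfrac{\lambda}{3}b^3+\tfrac14b^4$$ (an element of $\mathbb CQ$ modulo the linear span of commutators). Here the cyclic derivative with respect to an arrow $\alpha$ sends a closed path $p$ to the sum of $vu$ over all ways of writing $p=u\alpha v$. (ii) There is an isomorphism of $\mathbb C$-algebras $\mathbb CQ/I\cong\operatorname{End}_R(R\oplus M)$ which sends the trivial paths at the vertices $R$ and $M$ to the projections onto the summands $R$ and $M$, the arrow $d$ to the map $R\to M$ taking $1$ to the class of the fourth standard basis vector, the arrow $c$ to the map $M\to R$ induced by the first row $(x,-y,-z,w)$ of $\Phi$, and the loops $a$, $b$ to the endomorphisms of $M$ induced by the matrices $$\begin{pmatrix}0&1&0&0\\-u&0&0&0\\0&0&0&1\\0&0&-u&0\end{pmatrix},\qquad \begin{pmatrix}0&0&1&0\\0&0&0&-1\\-w&0&0&0\\0&w&0&0\end{pmatrix}$$ respectively. -/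

import Mathlib

/-! ### Path algebras, cyclic words and cyclic derivatives -/

/-- All paths of a quiver, with their source and target; the trivial paths are included. -/
abbrev QuiverPaths (Q : Type) [Quiver.{0} Q] : Type :=
  Σ i : Q, Σ j : Q, Quiver.Path i j

/-- The path algebra of a quiver: the vector space with basis the set of all paths. -/
def PathAlgebra (k Q : Type) [Field k] [Quiver.{0} Q] : Type :=
  QuiverPaths Q →₀ k

namespace PathAlgebra

section

variable (k : Type) {Q : Type} [Field k] [Quiver.{0} Q]

noncomputable instance : AddCommGroup (PathAlgebra k Q) :=
  inferInstanceAs (AddCommGroup (QuiverPaths Q →₀ k))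

noncomputable instance : Module k (PathAlgebra k Q) :=
  inferInstanceAs (Module k (QuiverPaths Q →₀ k))

/-- The basis element given by a path. -/
noncomputable def ofPath {i j : Q} (p : Quiver.Path i j) : PathAlgebra k Q :=
  Finsupp.single (⟨i, j, p⟩ : QuiverPaths Q) (1 : k)

/-- The trivial path (of length zero) at a vertex. -/
noncomputable def vertex (i : Q) : PathAlgebra k Q :=
  ofPath k (Quiver.Path.nil : Quiver.Path i i)

/-- An arrow as an element of the path algebra. -/
noncomputable def arrow {i j : Q} (e : i ⟶ j) : PathAlgebra k Q :=
  ofPath k e.toPath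

/-- The linear map out of the path algebra with given values on paths. -/
noncomputable def lift {V : Type} [AddCommGroup V] [Module k V] (g : QuiverPaths Q → V) :
    PathAlgebra k Q →ₗ[k] V :=
  Finsupp.linearCombination k g

theorem lift_ofPath {V : Type} [AddCommGroup V] [Module k V] (g : QuiverPaths Q → V)
    {i j : Q} (p : Quiver.Path i j) : lift k g (ofPath k p) = g ⟨i, j, p⟩ :=
  (Finsupp.linearCombination_single k (1 : k) (⟨i, j, p⟩ : QuiverPaths Q)).trans (one_smul k _)

theorem hom_ext {V : Type} [AddCommGroup V] [Module k V] {g h : PathAlgebra k Q →ₗ[k] V}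
    (H : ∀ (i j : Q) (p : Quiver.Path i j), g (ofPath k p) = h (ofPath k p)) : g = h :=
  Finsupp.lhom_ext' fun ⟨i, j, p⟩ => LinearMap.ext_ring (H i j p)

theorem induction_paths {motive : PathAlgebra k Q → Prop} (x : PathAlgebra k Q)
    (zero : motive 0) (add : ∀ x y, motive x → motive y → motive (x + y))
    (smul : ∀ (r : k) (x), motive x → motive (r • x))
    (path : ∀ {i j : Q} (p : Quiver.Path i j), motive (ofPath k p)) : motive x := by
  refine Finsupp.induction_linear (motive := motive) x zero add ?_
  rintro ⟨i, j, p⟩ r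
  have h : (Finsupp.single (⟨i, j, p⟩ : QuiverPaths Q) r) =
      r • Finsupp.single (⟨i, j, p⟩ : QuiverPaths Q) (1 : k) := by
    rw [Finsupp.smul_single, smul_eq_mul, mul_one]
  rw [h]
  exact smul r _ (path p)

variable [DecidableEq Q]

/-- The product of two paths. Paths are composed from right to left, like maps: `q * p` is
"first `p`, then `q`" if `p` ends where `q` starts, and `0` otherwise. -/
noncomputable def pathMul (q p : QuiverPaths Q) : PathAlgebra k Q :=
  if h : p.2.1 = q.1 then ofPath k (p.2.2.comp (q.2.2.cast h.symm rfl)) else 0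

noncomputable def mulHom : PathAlgebra k Q →ₗ[k] PathAlgebra k Q →ₗ[k] PathAlgebra k Q :=
  lift k fun q => lift k fun p => pathMul k q p

noncomputable instance : Mul (PathAlgebra k Q) := ⟨fun x y => mulHom k x y⟩

theorem mul_def (x y : PathAlgebra k Q) : x * y = mulHom k x y := rfl

theorem ofPath_mul_ofPath {i j l : Q} (q : Quiver.Path j l) (p : Quiver.Path i j) :
    ofPath k q * ofPath k p = ofPath k (p.comp q) := by
  simp [mul_def, mulHom, lift_ofPath, pathMul]

theorem ofPath_mul_ofPath_of_ne {i j j' l : Q} (q : Quiver.Path j' l) (p : Quiver.Path i j)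
    (h : j ≠ j') : ofPath k q * ofPath k p = 0 := by
  simp [mul_def, mulHom, lift_ofPath, pathMul, h]

theorem vertex_mul_ofPath {i j l : Q} (p : Quiver.Path i j) :
    vertex k l * ofPath k p = if j = l then ofPath k p else 0 := by
  split_ifs with h
  · subst h; simp [vertex, ofPath_mul_ofPath]
  · exact ofPath_mul_ofPath_of_ne k _ _ h

theorem ofPath_mul_vertex {i j l : Q} (p : Quiver.Path i j) :
    ofPath k p * vertex k l = if l = i then ofPath k p else 0 := by
  split_ifs with h
  · subst h; simp [vertex, ofPath_mul_ofPath]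
  · exact ofPath_mul_ofPath_of_ne k _ _ h

protected theorem mul_assoc (x y z : PathAlgebra k Q) : x * y * z = x * (y * z) := by
  induction x using induction_paths with
  | zero => simp [mul_def]
  | add x x' hx hx' => simp only [mul_def, map_add, LinearMap.add_apply] at *; rw [hx, hx']
  | smul r x hx => simp only [mul_def, map_smul, LinearMap.smul_apply] at *; rw [hx]
  | path x =>
  induction y using induction_paths with
  | zero => simp [mul_def]
  | add x x' hx hx' => simp only [mul_def, map_add, LinearMap.add_apply] at *; rw [hx, hx']
  | smul r x hx => simp only [mul_def, map_smul, LinearMap.smul_apply] at *; rw [hx]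
  | path y =>
  induction z using induction_paths with
  | zero => simp [mul_def]
  | add x x' hx hx' => simp only [mul_def, map_add] at *; rw [hx, hx']
  | smul r x hx => simp only [mul_def, map_smul] at *; rw [hx]
  | path z =>
  rename_i i₁ j₁ i₂ j₂ i₃ j₃
  by_cases h₁ : j₂ = i₁
  · subst h₁
    by_cases h₂ : j₃ = i₂
    · subst h₂
      simp [ofPath_mul_ofPath]
    · rw [ofPath_mul_ofPath, ofPath_mul_ofPath_of_ne k _ _ h₂, ofPath_mul_ofPath_of_ne k _ _ h₂]
      simp [mul_def]
  · by_cases h₂ : j₃ = i₂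
    · subst h₂
      rw [ofPath_mul_ofPath, ofPath_mul_ofPath_of_ne k _ _ h₁, ofPath_mul_ofPath_of_ne k _ _ h₁]
      simp [mul_def]
    · rw [ofPath_mul_ofPath_of_ne k _ _ h₁, ofPath_mul_ofPath_of_ne k _ _ h₂]
      simp [mul_def]

variable [Fintype Q]

/-- The unit is the sum of the trivial paths. -/
noncomputable instance : One (PathAlgebra k Q) := ⟨∑ i : Q, vertex k i⟩

protected theorem one_mul (x : PathAlgebra k Q) : 1 * x = x := by
  have : mulHom k (1 : PathAlgebra k Q) = LinearMap.id := by
    apply hom_ext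
    intro i j p
    rw [show (1 : PathAlgebra k Q) = ∑ i : Q, vertex k i from rfl, map_sum]
    simp only [LinearMap.sum_apply, ← mul_def, vertex_mul_ofPath]
    simp
  exact congrArg (fun g => g x) this

protected theorem mul_one (x : PathAlgebra k Q) : x * 1 = x := by
  have : (mulHom k).flip (1 : PathAlgebra k Q) = LinearMap.id := by
    apply hom_ext
    intro i j p
    rw [LinearMap.flip_apply, show (1 : PathAlgebra k Q) = ∑ i : Q, vertex k i from rfl, map_sum]
    simp only [← mul_def, ofPath_mul_vertex]
    simp
  exact congrArg (fun g => g x) this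

noncomputable instance : Ring (PathAlgebra k Q) where
  __ := (inferInstance : AddCommGroup (PathAlgebra k Q))
  mul_assoc := PathAlgebra.mul_assoc k
  one_mul := PathAlgebra.one_mul k
  mul_one := PathAlgebra.mul_one k
  zero_mul x := by simp [mul_def]
  mul_zero x := by simp [mul_def]
  left_distrib x y z := by simp [mul_def]
  right_distrib x y z := by simp [mul_def]

noncomputable instance : Algebra k (PathAlgebra k Q) :=
  Algebra.ofModule (fun r x y => by simp [mul_def]) (fun r x y => by simp [mul_def])

/-- The space of cyclic words: the path algebra modulo the linear span of all commutators.
Paths that are not closed vanish here, and closed paths are identified with their cyclic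
rotations. -/
abbrev Cyc (k Q : Type) [Field k] [Quiver.{0} Q] [DecidableEq Q] [Fintype Q] : Type :=
  PathAlgebra k Q ⧸
    Submodule.span k {v : PathAlgebra k Q | ∃ x y : PathAlgebra k Q, v = x * y - y * x}

/-- The class of an element of the path algebra in the space of cyclic words. -/
noncomputable def toCyc : PathAlgebra k Q →ₗ[k] Cyc k Q :=
  Submodule.mkQ _

open Classical in
/-- For an arrow `α` and a path `p`, the sum of `v * s * u` over all ways to write `p` as
`u * α * v`. -/
noncomputable def pathDeriv {i j : Q} (α : i ⟶ j) {l : Q} :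
    {m : Q} → Quiver.Path l m → PathAlgebra k Q → PathAlgebra k Q
  | _, .nil, _ => 0
  | _, .cons (b := b) (c := c) p e, s =>
    (if (⟨b, c, e⟩ : Σ b : Q, Σ c : Q, b ⟶ c) = ⟨i, j, α⟩ then ofPath k p * s else 0) +
      pathDeriv α p (s * arrow k e)

/-- The cyclic derivative on the path algebra: a closed path `p` at `m` goes to the sum of
`v * u` over all ways to write `p = u * α * v`; a path which is not closed goes to zero. -/
noncomputable def cycDerivLift {i j : Q} (α : i ⟶ j) : PathAlgebra k Q →ₗ[k] PathAlgebra k Q :=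
  lift k fun p => pathDeriv k α p.2.2 (vertex k p.2.1 * vertex k p.1)

theorem pathDeriv_zero {i j : Q} (α : i ⟶ j) {l m : Q} (p : Quiver.Path l m) :
    pathDeriv k α p 0 = 0 := by
  induction p with
  | nil => rfl
  | cons p e ih => simp [pathDeriv, ih]

theorem pathDeriv_comp {i j : Q} (α : i ⟶ j) {l m n : Q} (p : Quiver.Path l m)
    (q : Quiver.Path m n) (s : PathAlgebra k Q) (hs : s * vertex k n = s) :
    pathDeriv k α (p.comp q) s =
      pathDeriv k α q (ofPath k p * s) + pathDeriv k α p (s * ofPath k q) := by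
  induction q generalizing s with
  | nil =>
    change pathDeriv k α p s = 0 + pathDeriv k α p (s * vertex k m)
    rw [hs, zero_add]
  | cons q e ih =>
    have h₁ : ofPath k (q.cons e) = arrow k e * ofPath k q :=
      (ofPath_mul_ofPath k e.toPath q).symm
    have h₂ := ih (s * arrow k e) (by
      rw [mul_assoc, arrow, ofPath_mul_vertex, if_pos rfl])
    rw [Quiver.Path.comp_cons, pathDeriv, pathDeriv, h₂, h₁, ← ofPath_mul_ofPath]
    simp only [mul_assoc, add_assoc]

theorem cycDerivLift_ofPath {i j : Q} (α : i ⟶ j) {l m : Q} (p : Quiver.Path l m) :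
    cycDerivLift k α (ofPath k p) = pathDeriv k α p (vertex k m * vertex k l) :=
  lift_ofPath k _ p

theorem cycDerivLift_of_ne {i j : Q} (α : i ⟶ j) {l m : Q} (p : Quiver.Path l m) (h : l ≠ m) :
    cycDerivLift k α (ofPath k p) = 0 := by
  rw [cycDerivLift_ofPath, vertex, vertex, ofPath_mul_ofPath_of_ne k _ _ h, pathDeriv_zero]

theorem cycDerivLift_comp {i j : Q} (α : i ⟶ j) {l m : Q} (p : Quiver.Path l m)
    (q : Quiver.Path m l) :
    cycDerivLift k α (ofPath k (p.comp q)) =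
      pathDeriv k α q (ofPath k p) + pathDeriv k α p (ofPath k q) := by
  have h : vertex k l * vertex k l = vertex k l := by
    simp [vertex, ofPath_mul_ofPath]
  rw [cycDerivLift_ofPath, h, pathDeriv_comp k α p q _ h, ofPath_mul_vertex, if_pos rfl,
    vertex_mul_ofPath, if_pos rfl]

theorem cycDerivLift_mul_comm {i j : Q} (α : i ⟶ j) (x y : PathAlgebra k Q) :
    cycDerivLift k α (x * y) = cycDerivLift k α (y * x) := by
  induction x using induction_paths with
  | zero => simp
  | add x x' hx hx' => simp only [add_mul, mul_add, map_add, hx, hx']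
  | smul r x hx => simp only [smul_mul_assoc, mul_smul_comm, map_smul, hx]
  | path q =>
  induction y using induction_paths with
  | zero => simp
  | add x x' hx hx' => simp only [add_mul, mul_add, map_add, hx, hx']
  | smul r x hx => simp only [smul_mul_assoc, mul_smul_comm, map_smul, hx]
  | path p =>
  rename_i a b c d
  by_cases h₁ : d = a
  · subst h₁
    by_cases h₂ : b = c
    · subst h₂
      rw [ofPath_mul_ofPath, ofPath_mul_ofPath, cycDerivLift_comp, cycDerivLift_comp, add_comm]
    · rw [ofPath_mul_ofPath, ofPath_mul_ofPath_of_ne k _ _ h₂,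
        cycDerivLift_of_ne k _ _ (Ne.symm h₂), map_zero]
  · by_cases h₂ : b = c
    · subst h₂
      rw [ofPath_mul_ofPath, ofPath_mul_ofPath_of_ne k _ _ h₁,
        cycDerivLift_of_ne k _ _ (Ne.symm h₁), map_zero]
    · rw [ofPath_mul_ofPath_of_ne k _ _ h₁, ofPath_mul_ofPath_of_ne k _ _ h₂]

/-- The cyclic derivative `∂/∂α` with respect to an arrow `α`, on the space of cyclic words. -/
noncomputable def cycDeriv {i j : Q} (α : i ⟶ j) : Cyc k Q →ₗ[k] PathAlgebra k Q :=
  Submodule.liftQ _ (cycDerivLift k α) (by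
    rw [Submodule.span_le]
    rintro _ ⟨x, y, rfl⟩
    simp [cycDerivLift_mul_comm k α x y])

end

end PathAlgebra

/-! ### The hypersurface, the matrix factorization and the module -/

namespace MorrisonPinkham

open MvPolynomial

/-- The polynomial ring `ℂ[w, x, y, z]`, with the variables in this order. -/
abbrev S : Type := MvPolynomial (Fin 4) ℂ

noncomputable abbrev w : S := X 0
noncomputable abbrev x : S := X 1
noncomputable abbrev y : S := X 2
noncomputable abbrev z : S := X 3

/-- `f = x² + y³ + w z² + w³ y - λ w y² - λ w⁴`. -/
noncomputable def f (lam : ℂ) : S :=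
  x ^ 2 + y ^ 3 + w * z ^ 2 + w ^ 3 * y - C lam * w * y ^ 2 - C lam * w ^ 4

/-- The coordinate ring `R = ℂ[w, x, y, z] / (f)`. -/
abbrev R (lam : ℂ) : Type := S ⧸ Ideal.span {f lam}

/-- The abbreviation `u = y - λ w`. -/
noncomputable abbrev u (lam : ℂ) : S := y - C lam * w

noncomputable def Psi (lam : ℂ) : Matrix (Fin 4) (Fin 4) S :=
  !![x, y, z, -w;
     -(u lam * y), x, u lam * w, z;
     -(w * z), -w ^ 2, x, -y;
     u lam * w ^ 2, -(w * z), u lam * y, x]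

noncomputable def Phi (lam : ℂ) : Matrix (Fin 4) (Fin 4) S :=
  !![x, -y, -z, w;
     u lam * y, x, -(u lam * w), -z;
     w * z, w ^ 2, x, y;
     -(u lam * w ^ 2), w * z, -(u lam * y), x]

/-- The matrices of the endomorphisms `a` and `b` of `coker Ψ`. -/
noncomputable def matA (lam : ℂ) : Matrix (Fin 4) (Fin 4) S :=
  !![0, 1, 0, 0;
     -u lam, 0, 0, 0;
     0, 0, 0, 1;
     0, 0, -u lam, 0]

noncomputable def matB : Matrix (Fin 4) (Fin 4) S :=
  !![0, 0, 1, 0;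
     0, 0, 0, -1;
     -w, 0, 0, 0;
     0, w, 0, 0]

/-- The `R`-linear map `Rⁿ → Rᵐ` (on column vectors) given by a matrix with entries in `S`. -/
noncomputable def matMap (lam : ℂ) {m n : ℕ} (A : Matrix (Fin m) (Fin n) S) :
    (Fin n → R lam) →ₗ[R lam] (Fin m → R lam) :=
  (A.map (Ideal.Quotient.mk (Ideal.span {f lam}))).mulVecLin

theorem matMap_mul (lam : ℂ) {l m n : ℕ} (A : Matrix (Fin l) (Fin m) S)
    (B : Matrix (Fin m) (Fin n) S) : matMap lam (A * B) = matMap lam A ∘ₗ matMap lam B := by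
  rw [matMap, Matrix.map_mul, Matrix.mulVecLin_mul]
  rfl

/-- The module `M = coker Ψ`. -/
abbrev M (lam : ℂ) : Type := (Fin 4 → R lam) ⧸ LinearMap.range (matMap lam (Psi lam))

/-- A square matrix that commutes with `Ψ` induces an endomorphism of `M = coker Ψ`. -/
noncomputable def cokerEnd (lam : ℂ) (A : Matrix (Fin 4) (Fin 4) S)
    (h : A * Psi lam = Psi lam * A) : M lam →ₗ[R lam] M lam :=
  Submodule.mapQ _ _ (matMap lam A) (by
    rintro _ ⟨v, rfl⟩
    refine ⟨matMap lam A v, ?_⟩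
    rw [← LinearMap.comp_apply, ← LinearMap.comp_apply, ← matMap_mul, ← matMap_mul, h])

theorem matA_mul_Psi (lam : ℂ) : matA lam * Psi lam = Psi lam * matA lam := by
  refine Matrix.ext fun i j => ?_
  fin_cases i <;> fin_cases j <;>
    simp [matA, Psi, Matrix.mul_apply, Fin.sum_univ_four] <;> ring

theorem matB_mul_Psi (lam : ℂ) : matB * Psi lam = Psi lam * matB := by
  refine Matrix.ext fun i j => ?_
  fin_cases i <;> fin_cases j <;>
    simp [matB, Psi, Matrix.mul_apply, Fin.sum_univ_four] <;> ring

noncomputable def loopA (lam : ℂ) : M lam →ₗ[R lam] M lam :=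
  cokerEnd lam (matA lam) (matA_mul_Psi lam)

noncomputable def loopB (lam : ℂ) : M lam →ₗ[R lam] M lam :=
  cokerEnd lam matB (matB_mul_Psi lam)

/-- The first row `(x, -y, -z, w)` of `Φ`, as a linear map `R⁴ → R`. -/
noncomputable def rowC (lam : ℂ) : (Fin 4 → R lam) →ₗ[R lam] R lam :=
  LinearMap.proj 0 ∘ₗ matMap lam (Phi lam)

theorem Phi_mul_Psi_row (lam : ℂ) (j : Fin 4) :
    (Phi lam * Psi lam) 0 j = if j = 0 then f lam else 0 := by
  fin_cases j <;> simp [Phi, Psi, f, Matrix.mul_apply, Fin.sum_univ_four] <;> ring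

/-- The map `c : M → R` induced by the first row of `Φ`. -/
noncomputable def mapC (lam : ℂ) : M lam →ₗ[R lam] R lam :=
  Submodule.liftQ _ (rowC lam) (by
    rintro _ ⟨v, rfl⟩
    change (matMap lam (Phi lam) ∘ₗ matMap lam (Psi lam)) v 0 = 0
    rw [← matMap_mul]
    simp only [matMap, Matrix.mulVecLin_apply, Matrix.mulVec, dotProduct,
      Matrix.map_apply, Phi_mul_Psi_row]
    refine Finset.sum_eq_zero fun j _ => ?_
    split_ifs
    · rw [Ideal.Quotient.eq_zero_iff_mem.mpr (Ideal.mem_span_singleton_self _), zero_mul]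
    · rw [map_zero, zero_mul])

/-- The map `d : R → M` that sends `1` to the class of the fourth standard basis vector. -/
noncomputable def mapD (lam : ℂ) : R lam →ₗ[R lam] M lam :=
  LinearMap.toSpanSingleton (R lam) (M lam) (Submodule.Quotient.mk (Pi.single 3 1))

/-- `End_R(R ⊕ M)`. -/
abbrev EndRM (lam : ℂ) : Type := Module.End (R lam) (R lam × M lam)

/-- A homomorphism between summands of `R ⊕ M`, extended by zero to an element of
`End_R(R ⊕ M)`. -/
noncomputable def extRR (lam : ℂ) (g : R lam →ₗ[R lam] R lam) : EndRM lam :=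
  LinearMap.inl _ _ _ ∘ₗ g ∘ₗ LinearMap.fst _ _ _

noncomputable def extRM (lam : ℂ) (g : R lam →ₗ[R lam] M lam) : EndRM lam :=
  LinearMap.inr _ _ _ ∘ₗ g ∘ₗ LinearMap.fst _ _ _

noncomputable def extMR (lam : ℂ) (g : M lam →ₗ[R lam] R lam) : EndRM lam :=
  LinearMap.inl _ _ _ ∘ₗ g ∘ₗ LinearMap.snd _ _ _

noncomputable def extMM (lam : ℂ) (g : M lam →ₗ[R lam] M lam) : EndRM lam :=
  LinearMap.inr _ _ _ ∘ₗ g ∘ₗ LinearMap.snd _ _ _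

/-! ### The quiver, its relations and the superpotential -/

/-- The two vertices of the quiver. -/
inductive Vertex : Type
  | nodeR
  | nodeM
  deriving DecidableEq

instance : Fintype Vertex := ⟨{.nodeR, .nodeM}, fun v => by cases v <;> simp⟩

/-- The arrows `d : R → M`, `c : M → R` and the loops `a`, `b` at `M`. -/
inductive Arrow : Vertex → Vertex → Type
  | d : Arrow .nodeR .nodeM
  | c : Arrow .nodeM .nodeR
  | a : Arrow .nodeM .nodeM
  | b : Arrow .nodeM .nodeM

instance : Quiver Vertex := ⟨Arrow⟩

abbrev arrD : Vertex.nodeR ⟶ Vertex.nodeM := Arrow.d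
abbrev arrC : Vertex.nodeM ⟶ Vertex.nodeR := Arrow.c
abbrev arrA : Vertex.nodeM ⟶ Vertex.nodeM := Arrow.a
abbrev arrB : Vertex.nodeM ⟶ Vertex.nodeM := Arrow.b

/-- The path algebra of the quiver, without relations. -/
abbrev P : Type := PathAlgebra ℂ Vertex

noncomputable def eR : P := PathAlgebra.vertex ℂ Vertex.nodeR
noncomputable def eM : P := PathAlgebra.vertex ℂ Vertex.nodeM
noncomputable def a : P := PathAlgebra.arrow ℂ arrA
noncomputable def b : P := PathAlgebra.arrow ℂ arrB
noncomputable def c : P := PathAlgebra.arrow ℂ arrC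
noncomputable def d : P := PathAlgebra.arrow ℂ arrD

/-- The two-sided ideal of the path algebra generated by the four relations. -/
noncomputable def relIdeal (lam : ℂ) : TwoSidedIdeal P :=
  TwoSidedIdeal.span
    {(b ^ 2 + d * c) * d,
     c * (b ^ 2 + d * c),
     a * b + b * a,
     a ^ 2 + b * d * c + d * c * b + lam • b ^ 2 + b ^ 3}

/-- The path algebra of the quiver with relations. -/
abbrev A (lam : ℂ) : Type := (relIdeal lam).ringCon.Quotient

/-- The class of an element of the path algebra modulo the relations. -/
noncomputable def toA (lam : ℂ) (p : P) : A lam := (p : (relIdeal lam).ringCon.Quotient)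

/-- The superpotential
`W = b² d c + (1/2) d c d c + a² b + (λ/3) b³ + (1/4) b⁴`, as a cyclic word. -/
noncomputable def W (lam : ℂ) : PathAlgebra.Cyc ℂ Vertex :=
  PathAlgebra.toCyc ℂ
    (b ^ 2 * d * c + (1 / 2 : ℂ) • (d * c * d * c) + a ^ 2 * b + (lam / 3) • b ^ 3 +
      (1 / 4 : ℂ) • b ^ 4)

end MorrisonPinkham

/-! Over the polynomial ring `T` = ℂ[z, w, y] both modules become explicit. Since f is monic
quadratic in x, R = T ⊕ Tx. Let `H` be the quaternion algebra over `T` with i² = -u, j² = -w, and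
put X = yi + zj - wk (`quatX`). Then X² is the polynomial that x² equals in R, and M is `H` with x
acting by right multiplication by X: write Ψ = x + N with N free of x, so that Φ = x - N and N² = x²
in R; the columns of Ψ are exactly the rules for x. Under this identification (`quatToM_injective`,
`quatToM_surjective`) the loops a, b are left multiplication by i, j, the map d sends 1 to 1, and
c(h) = -imK(hX) - imK(h)x.

This determines all homomorphisms. A map R → M is an element of `H`. A map M → R is determined by
its x-coefficient, an arbitrary `T`-linear functional on `H`; since (q, v) ↦ imK(qv) is a perfect
pairing, it is v ↦ c(qv) for a unique q (`exists_eq_mapC_mul`, `mapC_quatToM_eq_zero`). An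
endomorphism of M is a `T`-linear map commuting with right multiplication by X, and has the form v ↦
pv + q·dc(v) with p, q unique (`exists_eq_mul_add_mul_quatDC`, `eq_zero_of_mul_add_mul_quatDC`).
Existence is the delicate point: it uses the factorization zy - wX = (z - wi)(y - wj) and a
divisibility argument for the norms of the two factors.

On the quiver side the relations make `cW`, `cY`, `cZ` central, so the quotient is a `T`-algebra.
Its elements all have the form s·eR + t·cabd + Hd + cH + H + Hdc (`exists_eq_normalForm`), because
such sums are stable under left multiplication by arrows. The induced map `quotHom` to End(R ⊕ M) is
`T`-linear and sends these six coefficients to the coordinates of the previous paragraph. Hence it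
is bijective, and uniqueness of normal forms need not be proved beforehand. -/

/-! ### The universal property of the path algebra -/

namespace PathAlgebra

section

variable {k Q B : Type} [Field k] [Quiver.{0} Q] [Ring B] [Algebra k B]

/-- The product of the images of the arrows along a path. -/
def evalPath (e : Q → B) (g : ∀ {i j : Q}, (i ⟶ j) → B) {i : Q} :
    {j : Q} → Quiver.Path i j → B
  | _, .nil => e i
  | _, .cons p α => g α * evalPath e g p

variable (e : Q → B) (g : ∀ {i j : Q}, (i ⟶ j) → B)

theorem evalPath_mul_idem (he : ∀ i, e i * e i = e i) {i j : Q} (p : Quiver.Path i j) :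
    evalPath e g p * e i = evalPath e g p := by
  induction p with
  | nil => exact he i
  | cons p α ih => rw [evalPath, mul_assoc, ih]

theorem idem_mul_evalPath (he : ∀ i, e i * e i = e i)
    (hg : ∀ {i j : Q} (α : i ⟶ j), e j * g α = g α) {i j : Q} (p : Quiver.Path i j) :
    e j * evalPath e g p = evalPath e g p := by
  cases p with
  | nil => exact he i
  | cons p α => rw [evalPath, ← mul_assoc, hg]

theorem evalPath_comp (he : ∀ i, e i * e i = e i)
    (hg : ∀ {i j : Q} (α : i ⟶ j), e j * g α = g α)
    {i j l : Q} (p : Quiver.Path i j) (q : Quiver.Path j l) :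
    evalPath e g (p.comp q) = evalPath e g q * evalPath e g p := by
  induction q with
  | nil => exact (idem_mul_evalPath e g he hg p).symm
  | cons q α ih => rw [Quiver.Path.comp_cons, evalPath, evalPath, ih, mul_assoc]

variable [DecidableEq Q] [Fintype Q]

/-- The algebra homomorphism out of the path algebra given by a complete system of orthogonal
idempotents and compatible images of the arrows. -/
noncomputable def liftAlgHom (he : ∀ i, e i * e i = e i) (hne : ∀ i j, i ≠ j → e i * e j = 0)
    (hsum : ∑ i, e i = 1) (hl : ∀ {i j : Q} (α : i ⟶ j), e j * g α = g α) :
    PathAlgebra k Q →ₐ[k] B :=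
  AlgHom.ofLinearMap (lift k fun p => evalPath e g p.2.2)
    (by
      rw [show (1 : PathAlgebra k Q) = ∑ i : Q, vertex k i from rfl, map_sum, ← hsum]
      exact Finset.sum_congr rfl fun i _ => lift_ofPath k _ _)
    (by
      intro x y
      induction x using induction_paths with
      | zero => simp
      | add x x' hx hx' => simp only [add_mul, map_add, hx, hx']
      | smul r x hx => simp only [smul_mul_assoc, map_smul, hx]
      | path q =>
      induction y using induction_paths with
      | zero => simp
      | add x x' hx hx' => simp only [mul_add, map_add, hx, hx']
      | smul r x hx => simp only [mul_smul_comm, map_smul, hx]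
      | path p =>
      rename_i i₁ j₁ i₂ j₂
      by_cases h : j₂ = i₁
      · subst h
        rw [ofPath_mul_ofPath, lift_ofPath, lift_ofPath, lift_ofPath]
        exact evalPath_comp e g he hl p q
      · rw [ofPath_mul_ofPath_of_ne k _ _ h, map_zero, lift_ofPath, lift_ofPath]
        change 0 = evalPath e g q * evalPath e g p
        rw [← evalPath_mul_idem e g he q, ← idem_mul_evalPath e g he hl p, mul_assoc,
          ← mul_assoc (e i₁), hne _ _ (Ne.symm h), zero_mul, mul_zero])

theorem liftAlgHom_vertex (he hne hsum hl) (i : Q) :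
    liftAlgHom (k := k) e g he hne hsum hl (vertex k i) = e i :=
  lift_ofPath k _ _

/-- A path of length one evaluates to `g α * e i`, because `evalPath` starts from the idempotent at
the source; the right compatibility `hr` removes that factor. -/
theorem liftAlgHom_arrow (he hne hsum hl) {i j : Q} (α : i ⟶ j) (hr : g α * e i = g α) :
    liftAlgHom (k := k) e g he hne hsum hl (arrow k α) = g α :=
  (lift_ofPath k _ _).trans hr

variable (k)

/-- A subspace of the path algebra that contains the vertices and is stable under left
multiplication by the arrows is everything. -/
theorem induction_arrows {motive : PathAlgebra k Q → Prop} (x : PathAlgebra k Q)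
    (zero : motive 0) (add : ∀ x y, motive x → motive y → motive (x + y))
    (smul : ∀ (r : k) (x), motive x → motive (r • x))
    (vertex : ∀ i, motive (vertex k i))
    (arrow : ∀ {i j : Q} (α : i ⟶ j) (x), motive x → motive (arrow k α * x)) : motive x := by
  induction x using induction_paths with
  | zero => exact zero
  | add x y hx hy => exact add x y hx hy
  | smul r x hx => exact smul r x hx
  | path p =>
    induction p with
    | nil => exact vertex _
    | cons p α ih =>
      have := arrow α _ ih
      rwa [PathAlgebra.arrow, ofPath_mul_ofPath] at this

end

end PathAlgebra

/-! ### The matrix factorization and the cyclic derivatives of the superpotential -/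

namespace MorrisonPinkham

open MvPolynomial

theorem Phi_mul_Psi (lam : ℂ) :
    Phi lam * Psi lam = f lam • (1 : Matrix (Fin 4) (Fin 4) S) := by
  refine Matrix.ext fun i j => ?_
  fin_cases i <;> fin_cases j <;>
    simp [Phi, Psi, f, Matrix.mul_apply, Fin.sum_univ_four] <;> ring

theorem Psi_mul_Phi (lam : ℂ) :
    Psi lam * Phi lam = f lam • (1 : Matrix (Fin 4) (Fin 4) S) := by
  refine Matrix.ext fun i j => ?_
  fin_cases i <;> fin_cases j <;>
    simp [Phi, Psi, f, Matrix.mul_apply, Fin.sum_univ_four] <;> ring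

theorem cycDeriv_toCyc {i j : Vertex} (α : i ⟶ j) (p : P) :
    PathAlgebra.cycDeriv ℂ α (PathAlgebra.toCyc ℂ p) = PathAlgebra.cycDerivLift ℂ α p :=
  rfl

section

open PathAlgebra

theorem cycDeriv_W (lam : ℂ) :
    cycDeriv ℂ arrC (W lam) = (b ^ 2 + d * c) * d ∧
      cycDeriv ℂ arrD (W lam) = c * (b ^ 2 + d * c) ∧
      cycDeriv ℂ arrA (W lam) = a * b + b * a ∧
      cycDeriv ℂ arrB (W lam) = a ^ 2 + b * d * c + d * c * b + lam • b ^ 2 + b ^ 3 := by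
  -- `cycDerivLift` starts with the product of the two end vertices, which is a vertex idempotent on
  -- closed paths; all terms of W are here written as closed paths at M.
  have hMM : vertex ℂ Vertex.nodeM * vertex ℂ Vertex.nodeM = vertex ℂ Vertex.nodeM :=
    ofPath_mul_ofPath ℂ _ _
  simp only [W, cycDeriv_toCyc, map_add, map_smul, pow_succ, pow_zero, one_mul, mul_add, add_mul,
    a, b, c, d, arrow, ofPath_mul_ofPath, cycDerivLift_ofPath, hMM, pathDeriv, Quiver.Hom.toPath,
    Quiver.Path.comp_cons, Quiver.Path.comp_nil, arrA, arrB, arrC, arrD]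
  simp only [vertex, ofPath_mul_ofPath, Quiver.Path.comp_cons, Quiver.Path.comp_nil]
  simp
  -- The coefficients 1/2, λ/3, 1/4 cancel the multiplicities: each arrow occurs twice in dcdc,
  -- three times in b³ and four times in b⁴.
  refine ⟨?_, ?_, ?_⟩ <;> module

end

end MorrisonPinkham

/-! ### `R` and `M` as free modules over `ℂ[w, y, z]` -/

namespace MorrisonPinkham

open MvPolynomial

/-- The polynomial ring `ℂ[z, w, y]`, with the variables in this order. -/
abbrev T : Type := MvPolynomial (Fin 3) ℂ

noncomputable abbrev tz : T := X 0
noncomputable abbrev tw : T := X 1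
noncomputable abbrev ty : T := X 2
noncomputable abbrev tu (lam : ℂ) : T := ty - C lam * tw

/-- The class of a polynomial in `R`. -/
noncomputable abbrev toR (lam : ℂ) : S →ₐ[ℂ] R lam := Ideal.Quotient.mkₐ ℂ (Ideal.span {f lam})

/-- The inclusion of `ℂ[w, y, z]` in `R`. -/
noncomputable def incl (lam : ℂ) : T →ₐ[ℂ] R lam :=
  aeval ![toR lam z, toR lam w, toR lam y]

@[simp] theorem incl_tz (lam : ℂ) : incl lam tz = toR lam z := by
  simp [incl]

@[simp] theorem incl_tw (lam : ℂ) : incl lam tw = toR lam w := by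
  simp [incl]

@[simp] theorem incl_ty (lam : ℂ) : incl lam ty = toR lam y := by
  simp [incl]

@[simp] theorem incl_C (lam r : ℂ) : incl lam (C r) = algebraMap ℂ (R lam) r := by
  simp [incl]

@[simp] theorem toR_C (lam r : ℂ) : toR lam (C r) = algebraMap ℂ (R lam) r := rfl

/-- The square of `x` in `R`, as a polynomial in `w`, `y`, `z`. -/
noncomputable def xSq (lam : ℂ) : T := -(tu lam * ty ^ 2 + tw * tz ^ 2 + tu lam * tw ^ 3)

theorem toR_f (lam : ℂ) : toR lam (f lam) = 0 :=
  Ideal.Quotient.eq_zero_iff_mem.mpr (Ideal.mem_span_singleton_self _)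

theorem toR_x_sq (lam : ℂ) : toR lam x * toR lam x = incl lam (xSq lam) := by
  have h := toR_f lam
  simp only [f, map_add, map_sub, map_mul, map_pow, toR_C] at h
  simp only [xSq, map_add, map_sub, map_mul, map_pow, map_neg, incl_tz, incl_tw,
    incl_ty, incl_C]
  linear_combination h

theorem exists_coords (lam : ℂ) (r : R lam) :
    ∃ s t : T, r = incl lam s + incl lam t * toR lam x := by
  obtain ⟨p, rfl⟩ := Ideal.Quotient.mk_surjective r
  change ∃ s t : T, toR lam p = _
  induction p using MvPolynomial.induction_on with
  | C r => exact ⟨C r, 0, by simp⟩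
  | add p q hp hq =>
    obtain ⟨s, t, h⟩ := hp
    obtain ⟨s', t', h'⟩ := hq
    exact ⟨s + s', t + t', by rw [map_add, h, h', map_add, map_add]; ring⟩
  | mul_X p n hp =>
    obtain ⟨s, t, h⟩ := hp
    rw [map_mul, h]
    fin_cases n
    · refine ⟨s * tw, t * tw, ?_⟩
      change _ * toR lam w = _
      simp only [map_mul, incl_tw]
      ring
    · refine ⟨t * xSq lam, s, ?_⟩
      change _ * toR lam x = _
      simp only [map_mul, ← toR_x_sq]
      ring
    · refine ⟨s * ty, t * ty, ?_⟩
      change _ * toR lam y = _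
      simp only [map_mul, incl_ty]
      ring
    · refine ⟨s * tz, t * tz, ?_⟩
      change _ * toR lam z = _
      simp only [map_mul, incl_tz]
      ring

/-- The homomorphism from `R` to the quadratic algebra `T[ω]` with `ω² = x²`. -/
noncomputable def toQuadratic (lam : ℂ) : R lam →ₐ[ℂ] QuadraticAlgebra T (xSq lam) 0 :=
  Ideal.Quotient.liftₐ _
    (aeval ![algebraMap T _ tw, QuadraticAlgebra.omega, algebraMap T _ ty, algebraMap T _ tz])
    (fun p hp => by
      obtain ⟨q, rfl⟩ := Ideal.mem_span_singleton'.mp hp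
      rw [map_mul]
      convert mul_zero _
      have hω : (QuadraticAlgebra.omega : QuadraticAlgebra T (xSq lam) 0) ^ 2 =
          algebraMap T _ (xSq lam) := by
        ext <;> simp [pow_two]
      have hC : algebraMap ℂ (QuadraticAlgebra T (xSq lam) 0) lam = algebraMap T _ (C lam) := rfl
      simp only [f, map_add, map_sub, map_mul, map_pow, aeval_C, aeval_X, Matrix.cons_val, hω, hC]
      simp only [← map_add, ← map_sub, ← map_mul, ← map_pow]
      rw [← map_zero (algebraMap T (QuadraticAlgebra T (xSq lam) 0))]
      congr 1
      rw [xSq]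
      ring)

theorem toQuadratic_toR (lam : ℂ) (p : S) :
    toQuadratic lam (toR lam p) = aeval ![algebraMap T _ tw, QuadraticAlgebra.omega,
      algebraMap T _ ty, algebraMap T _ tz] p :=
  rfl

theorem toQuadratic_incl (lam : ℂ) (t : T) :
    toQuadratic lam (incl lam t) = algebraMap T _ t := by
  have : ((toQuadratic lam).comp (incl lam)) =
      IsScalarTower.toAlgHom ℂ T (QuadraticAlgebra T (xSq lam) 0) := by
    refine MvPolynomial.algHom_ext fun i => ?_
    fin_cases i
    · change toQuadratic lam (incl lam tz) = algebraMap T _ tz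
      rw [incl_tz, toQuadratic_toR, aeval_X]
      rfl
    · change toQuadratic lam (incl lam tw) = algebraMap T _ tw
      rw [incl_tw, toQuadratic_toR, aeval_X]
      rfl
    · change toQuadratic lam (incl lam ty) = algebraMap T _ ty
      rw [incl_ty, toQuadratic_toR, aeval_X]
      rfl
  exact congrArg (fun g => g t) this

theorem toQuadratic_x (lam : ℂ) : toQuadratic lam (toR lam x) = QuadraticAlgebra.omega := by
  rw [toQuadratic_toR, aeval_X]
  rfl

/-- In the quadratic algebra 1 and ω are independent over `T`, so the images under `toQuadratic`
separate the two coefficients. -/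
theorem coords_unique (lam : ℂ) {s t s' t' : T}
    (h : incl lam s + incl lam t * toR lam x =
      incl lam s' + incl lam t' * toR lam x) : s = s' ∧ t = t' := by
  have h := congrArg (toQuadratic lam) h
  simp only [map_add, map_mul, toQuadratic_incl, toQuadratic_x] at h
  have h₁ := congrArg QuadraticAlgebra.re h
  have h₂ := congrArg QuadraticAlgebra.im h
  simp at h₁ h₂
  exact ⟨h₁, h₂⟩

/-- The quaternion algebra over `T` with `i² = -u` and `j² = -w`. -/
abbrev H (lam : ℂ) : Type := QuaternionAlgebra T (-tu lam) 0 (-tw)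

/-- The classes in `M` of the standard basis vectors. -/
noncomputable def basisM (lam : ℂ) (i : Fin 4) : M lam := Submodule.Quotient.mk (Pi.single i 1)

theorem mk_eq_sum (lam : ℂ) (v : Fin 4 → R lam) :
    (Submodule.Quotient.mk v : M lam) = ∑ i, v i • basisM lam i := by
  conv_lhs => rw [pi_eq_sum_univ' v]
  simp only [← Submodule.mkQ_apply, map_sum, map_smul]
  rfl

theorem matMap_apply (lam : ℂ) {m n : ℕ} (A : Matrix (Fin m) (Fin n) S) (v : Fin n → R lam)
    (i : Fin m) : matMap lam A v i = ∑ j, toR lam (A i j) * v j :=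
  rfl

theorem sum_Psi_smul_basisM (lam : ℂ) (j : Fin 4) :
    ∑ i, toR lam (Psi lam i j) • basisM lam i = 0 := by
  have h : (Submodule.Quotient.mk (matMap lam (Psi lam) (Pi.single j 1)) : M lam) = 0 :=
    (Submodule.Quotient.mk_eq_zero _).mpr ⟨_, rfl⟩
  rw [mk_eq_sum] at h
  simpa [matMap_apply, Pi.single_apply] using h

theorem loopA_mk (lam : ℂ) (v : Fin 4 → R lam) :
    loopA lam (Submodule.Quotient.mk v) = Submodule.Quotient.mk (matMap lam (matA lam) v) := rfl

theorem loopB_mk (lam : ℂ) (v : Fin 4 → R lam) :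
    loopB lam (Submodule.Quotient.mk v) = Submodule.Quotient.mk (matMap lam matB v) := rfl

theorem loopA_basisM (lam : ℂ) (j : Fin 4) :
    loopA lam (basisM lam j) = ∑ i, toR lam (matA lam i j) • basisM lam i := by
  rw [basisM, loopA_mk, mk_eq_sum]
  simp [matMap_apply, Pi.single_apply]

theorem loopB_basisM (lam : ℂ) (j : Fin 4) :
    loopB lam (basisM lam j) = ∑ i, toR lam (matB i j) • basisM lam i := by
  rw [basisM, loopB_mk, mk_eq_sum]
  simp [matMap_apply, Pi.single_apply]

theorem mapC_basisM (lam : ℂ) (j : Fin 4) :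
    mapC lam (basisM lam j) = toR lam (Phi lam 0 j) := by
  change matMap lam (Phi lam) (Pi.single j 1) 0 = _
  simp [matMap_apply, Pi.single_apply]

/-- The identification of the quaternion algebra with `M` that sends `1` to the class of the
fourth standard basis vector and left multiplication by `i` and `j` to `a` and `b`. -/
noncomputable def quatToM (lam : ℂ) : H lam →+ M lam where
  toFun h := incl lam h.re • basisM lam 3 + incl lam h.imI • basisM lam 2 -
    incl lam h.imJ • basisM lam 1 - incl lam h.imK • basisM lam 0
  map_zero' := by
    simp only [QuaternionAlgebra.re_zero, QuaternionAlgebra.imI_zero, QuaternionAlgebra.imJ_zero,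
      QuaternionAlgebra.imK_zero, map_zero]
    module
  map_add' h h' := by
    simp only [QuaternionAlgebra.re_add, QuaternionAlgebra.imI_add, QuaternionAlgebra.imJ_add,
      QuaternionAlgebra.imK_add, map_add]
    module

theorem quatToM_apply (lam : ℂ) (h : H lam) :
    quatToM lam h = incl lam h.re • basisM lam 3 + incl lam h.imI • basisM lam 2 -
      incl lam h.imJ • basisM lam 1 - incl lam h.imK • basisM lam 0 := rfl

theorem quatToM_smul (lam : ℂ) (t : T) (h : H lam) :
    quatToM lam (t • h) = incl lam t • quatToM lam h := by
  simp only [quatToM_apply, QuaternionAlgebra.re_smul, QuaternionAlgebra.imI_smul,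
    QuaternionAlgebra.imJ_smul, QuaternionAlgebra.imK_smul, smul_eq_mul, map_mul]
  module

/-- The quaternion by which `x` acts on `M` from the right. -/
noncomputable def quatX (lam : ℂ) : H lam := ⟨0, ty, tz, -tw⟩

noncomputable def quatI (lam : ℂ) : H lam := ⟨0, 1, 0, 0⟩
noncomputable def quatJ (lam : ℂ) : H lam := ⟨0, 0, 1, 0⟩
noncomputable def quatK (lam : ℂ) : H lam := ⟨0, 0, 0, 1⟩

theorem quatToM_one (lam : ℂ) : quatToM lam 1 = basisM lam 3 := by
  simp [quatToM_apply]
  module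

theorem quatToM_quatI_mul (lam : ℂ) (h : H lam) :
    quatToM lam (quatI lam * h) = loopA lam (quatToM lam h) := by
  simp only [quatToM_apply, map_add, map_sub, map_smul, loopA_basisM, Fin.sum_univ_four]
  simp [matA, quatI, -Ideal.Quotient.mkₐ_eq_mk]
  module

theorem quatToM_quatJ_mul (lam : ℂ) (h : H lam) :
    quatToM lam (quatJ lam * h) = loopB lam (quatToM lam h) := by
  simp only [quatToM_apply, map_add, map_sub, map_smul, loopB_basisM, Fin.sum_univ_four]
  simp [matB, quatJ, -Ideal.Quotient.mkₐ_eq_mk]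
  module

/-- With Ψ = x + N, the relation given by column j says x·eⱼ = -(column j of N), and -N is right
multiplication by X in the basis -k, -j, i, 1. -/
theorem quatToM_mul_quatX (lam : ℂ) (h : H lam) :
    quatToM lam (h * quatX lam) = toR lam x • quatToM lam h := by
  have h0 := sum_Psi_smul_basisM lam 0
  have h1 := sum_Psi_smul_basisM lam 1
  have h2 := sum_Psi_smul_basisM lam 2
  have h3 := sum_Psi_smul_basisM lam 3
  simp only [Fin.sum_univ_four, Psi, Matrix.cons_val, Matrix.of_apply, map_neg, map_mul, map_sub,
    map_pow, toR_C] at h0 h1 h2 h3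
  simp only [quatToM_apply, quatX, QuaternionAlgebra.re_mul, QuaternionAlgebra.imI_mul,
    QuaternionAlgebra.imJ_mul, QuaternionAlgebra.imK_mul, map_neg, map_mul, map_sub, map_add,
    incl_C, incl_tw, incl_ty, incl_tz, map_zero]
  linear_combination (norm := module) incl lam h.imK • h0 + incl lam h.imJ • h1 -
    incl lam h.imI • h2 - incl lam h.re • h3

/-- Independence of the standard basis vectors over `ℂ[w, y, z]`. -/
theorem quatToM_injective (lam : ℂ) : Function.Injective (quatToM lam) := by
  rw [injective_iff_map_eq_zero]
  intro h hh
  have hv : (Submodule.Quotient.mk ![-incl lam h.imK, -incl lam h.imJ, incl lam h.imI,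
      incl lam h.re] : M lam) = 0 := by
    rw [← hh, mk_eq_sum, quatToM_apply, Fin.sum_univ_four]
    simp only [Matrix.cons_val]
    module
  obtain ⟨v, hv⟩ := (Submodule.Quotient.mk_eq_zero _).mp hv
  choose s t hst using fun i => exists_coords lam (v i)
  -- With v = s + tx, a row of Ψv lying in `T` has vanishing x-coefficient: s + Nt = 0, while x²t +
  -- Ns is the prescribed vector.
  have key (i : Fin 4) (r : T) (hr : matMap lam (Psi lam) v i = incl lam r)
      (p q : T) (hp : incl lam p + incl lam q * toR lam x = matMap lam (Psi lam) v i) :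
      p = r ∧ q = 0 := coords_unique lam (by rw [hp, hr, map_zero]; ring)
  have k0 := key 0 (-h.imK) (by rw [hv, map_neg]; rfl)
    (xSq lam * t 0 + ty * s 1 + tz * s 2 - tw * s 3) (s 0 + ty * t 1 + tz * t 2 - tw * t 3) (by
      simp only [matMap_apply, Fin.sum_univ_four, hst, Psi, Matrix.cons_val, Matrix.of_apply,
        map_neg, map_mul, map_sub, map_add, incl_tw, incl_ty, incl_tz]
      linear_combination (-incl lam (t 0)) * toR_x_sq lam)
  have k1 := key 1 (-h.imJ) (by rw [hv, map_neg]; rfl)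
    (-tu lam * ty * s 0 + xSq lam * t 1 + tu lam * tw * s 2 + tz * s 3)
    (-tu lam * ty * t 0 + s 1 + tu lam * tw * t 2 + tz * t 3) (by
      simp only [matMap_apply, Fin.sum_univ_four, hst, Psi, Matrix.cons_val, Matrix.of_apply,
        map_neg, map_mul, map_sub, map_add, toR_C, incl_C, incl_tw, incl_ty, incl_tz]
      linear_combination (-incl lam (t 1)) * toR_x_sq lam)
  have k2 := key 2 (h.imI) (by rw [hv]; rfl)
    (-tw * tz * s 0 - tw ^ 2 * s 1 + xSq lam * t 2 - ty * s 3)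
    (-tw * tz * t 0 - tw ^ 2 * t 1 + s 2 - ty * t 3) (by
      simp only [matMap_apply, Fin.sum_univ_four, hst, Psi, Matrix.cons_val, Matrix.of_apply,
        map_neg, map_mul, map_sub, map_add, map_pow, incl_tw, incl_ty, incl_tz]
      linear_combination (-incl lam (t 2)) * toR_x_sq lam)
  have k3 := key 3 (h.re) (by rw [hv]; rfl)
    (tu lam * tw ^ 2 * s 0 - tw * tz * s 1 + tu lam * ty * s 2 + xSq lam * t 3)
    (tu lam * tw ^ 2 * t 0 - tw * tz * t 1 + tu lam * ty * t 2 + s 3) (by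
      simp only [matMap_apply, Fin.sum_univ_four, hst, Psi, Matrix.cons_val, Matrix.of_apply,
        map_neg, map_mul, map_sub, map_add, map_pow, toR_C, incl_C, incl_tw, incl_ty, incl_tz]
      linear_combination (-incl lam (t 3)) * toR_x_sq lam)
  rw [xSq] at k0 k1 k2 k3
  obtain ⟨k0, l0⟩ := k0
  obtain ⟨k1, l1⟩ := k1
  obtain ⟨k2, l2⟩ := k2
  obtain ⟨k3, l3⟩ := k3
  -- Substituting s = -Nt in the `T`-parts leaves (x² - N²)t, which is zero.
  ext1
  · change h.re = 0
    linear_combination -k3 + tu lam * tw ^ 2 * l0 - tw * tz * l1 + tu lam * ty * l2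
  · change h.imI = 0
    linear_combination -k2 - tw * tz * l0 - tw ^ 2 * l1 - ty * l3
  · change h.imJ = 0
    linear_combination k1 + tu lam * ty * l0 - tu lam * tw * l2 - tz * l3
  · change h.imK = 0
    linear_combination k0 - ty * l1 - tz * l2 + tw * l3

/-- The standard basis vectors generate M over R and lie in the image; the image is an R-submodule
since x acts through right multiplication by X. -/
theorem quatToM_surjective (lam : ℂ) : Function.Surjective (quatToM lam) := by
  have hr (r : R lam) (h : H lam) : ∃ h', quatToM lam h' = r • quatToM lam h := by
    obtain ⟨s, t, rfl⟩ := exists_coords lam r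
    refine ⟨s • h + t • (h * quatX lam), ?_⟩
    rw [map_add, quatToM_smul, quatToM_smul, quatToM_mul_quatX, add_smul, mul_smul]
  have hb (i : Fin 4) : ∃ h', quatToM lam h' = basisM lam i := by
    fin_cases i
    · exact ⟨⟨0, 0, 0, -1⟩, by simp [quatToM_apply]; module⟩
    · exact ⟨⟨0, 0, -1, 0⟩, by simp [quatToM_apply]; module⟩
    · exact ⟨⟨0, 1, 0, 0⟩, by simp [quatToM_apply]; module⟩
    · exact ⟨⟨1, 0, 0, 0⟩, by simp [quatToM_apply]; module⟩
  intro m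
  obtain ⟨v, rfl⟩ := Submodule.Quotient.mk_surjective _ m
  choose b hb using hb
  choose g hg using fun i => hr (v i) (b i)
  exact ⟨∑ i, g i, by simp only [map_sum, hg, hb, mk_eq_sum]⟩

end MorrisonPinkham

/-! ### Endomorphisms of the quaternion algebra commuting with `x` -/

namespace MorrisonPinkham

open MvPolynomial

/-- `z² + w² u` is monic in `z` and `y² + w³` does not involve `z`. -/
theorem dvd_of_dvd_mul (lam : ℂ) {p : T}
    (h : tz ^ 2 + tw ^ 2 * tu lam ∣ (ty ^ 2 + tw ^ 3) * p) : tz ^ 2 + tw ^ 2 * tu lam ∣ p := by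
  -- This views `T` as polynomials in its first variable z over ℂ[w, y]. Division by a monic
  -- polynomial is linear over the coefficients, so the nonzero constant y² + w³ can be cancelled in
  -- the remainder.
  let e := finSuccEquiv ℂ 2
  have he : ∀ {q q' : T}, q ∣ q' ↔ e q ∣ e q' := fun {q q'} => (map_dvd_iff e).symm
  have h0 : e tz = Polynomial.X := finSuccEquiv_X_zero
  have h1 : e tw = Polynomial.C (X 0) := finSuccEquiv_X_succ (j := 0)
  have h2 : e ty = Polynomial.C (X 1) := finSuccEquiv_X_succ (j := 1)
  have hC : e (C lam) = Polynomial.C (C lam) := by simp [e, finSuccEquiv_apply]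
  have hg : e (tz ^ 2 + tw ^ 2 * tu lam) =
      Polynomial.X ^ 2 + Polynomial.C ((X 0) ^ 2 * (X 1 - C lam * X 0)) := by
    simp [h0, h1, h2, hC]
  have hs : e (ty ^ 2 + tw ^ 3) = Polynomial.C ((X 1) ^ 2 + (X 0) ^ 3) := by
    simp [h1, h2]
  have hs0 : (X 1 ^ 2 + X 0 ^ 3 : MvPolynomial (Fin 2) ℂ) ≠ 0 := fun h => by
    have := congrArg (eval ![0, 1]) h
    simp at this
  rw [he] at h ⊢
  rw [map_mul, hs, hg, ← Polynomial.smul_eq_C_mul] at h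
  rw [hg]
  have hm := Polynomial.monic_X_pow_add_C ((X 0) ^ 2 * (X 1 - C lam * X 0) :
    MvPolynomial (Fin 2) ℂ) two_ne_zero
  rw [← Polynomial.modByMonic_eq_zero_iff_dvd hm, Polynomial.smul_modByMonic] at h
  rw [← Polynomial.modByMonic_eq_zero_iff_dvd hm]
  exact (smul_eq_zero.mp h).resolve_left hs0

theorem tz_sq_add_ne_zero (lam : ℂ) : tz ^ 2 + tw ^ 2 * tu lam ≠ 0 := fun h => by
  have := congrArg (eval ![1, 0, 0]) h
  simp at this

theorem tw_ne_zero : tw ≠ 0 := X_ne_zero 1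

instance (lam : ℂ) : Module.IsTorsionFree T (H lam) :=
  Module.IsTorsionFree.of_smul_eq_zero fun t h hh => by
    rcases eq_or_ne t 0 with ht | ht
    · exact .inl ht
    · refine .inr (QuaternionAlgebra.ext ?_ ?_ ?_ ?_)
      · exact (mul_eq_zero.mp (congrArg QuaternionAlgebra.re hh)).resolve_left ht
      · exact (mul_eq_zero.mp (congrArg QuaternionAlgebra.imI hh)).resolve_left ht
      · exact (mul_eq_zero.mp (congrArg QuaternionAlgebra.imJ hh)).resolve_left ht
      · exact (mul_eq_zero.mp (congrArg QuaternionAlgebra.imK hh)).resolve_left ht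

theorem quat_eq_sum (lam : ℂ) (h : H lam) :
    h = h.re • 1 + h.imI • quatI lam + h.imJ • quatJ lam + h.imK • quatK lam := by
  ext1 <;> simp [quatI, quatJ, quatK]

/-- The endomorphism `d c` of `M`, on the quaternion algebra. -/
noncomputable def quatDC (lam : ℂ) (h : H lam) : H lam :=
  (-(h * quatX lam).imK) • 1 + (-h.imK) • quatX lam

/-- Since d sends r to r·1, dc(h) is c(h) = -imK(hX) - imK(h)x with x replaced by X. The first
coefficient is expanded here. -/
theorem quatDC_eq (lam : ℂ) (h : H lam) :
    quatDC lam h = (tw * h.re - tz * h.imI + ty * h.imJ) • 1 - h.imK • quatX lam := by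
  rw [quatDC, sub_eq_add_neg, neg_smul _ (quatX lam)]
  congr 2
  simp [quatX]
  ring

/-- The norm of z + wi; this and the next two identities permit inverting the factors of zy - wX up
to a central scalar. -/
theorem mul_quatConj (lam : ℂ) (h : H lam) :
    h * (tz • 1 + tw • quatI lam) * (tz • 1 - tw • quatI lam) = (tz ^ 2 + tw ^ 2 * tu lam) • h := by
  ext1 <;> simp [quatI] <;> ring

theorem mul_quatConj' (lam : ℂ) (h : H lam) :
    h * (tz • 1 - tw • quatI lam) * (tz • 1 + tw • quatI lam) = (tz ^ 2 + tw ^ 2 * tu lam) • h := by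
  ext1 <;> simp [quatI] <;> ring

theorem mul_quatConjJ (lam : ℂ) (h : H lam) :
    h * (ty • 1 - tw • quatJ lam) * (ty • 1 + tw • quatJ lam) = (ty ^ 2 + tw ^ 3) • h := by
  ext1 <;> simp [quatJ] <;> ring

/-- As dc(1) = w and dc(i) = -z, the values at 1 and i give p = -wq and q(z + wi) = 0. The norm of z
+ wi is nonzero and `H` is torsion-free over `T`. -/
theorem eq_zero_of_mul_add_mul_quatDC (lam : ℂ) (p q : H lam)
    (h : ∀ v, p * v + q * quatDC lam v = 0) : p = 0 ∧ q = 0 := by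
  have h1 : p = -tw • q := by
    have := h 1
    have h1 : quatDC lam 1 = tw • 1 := by
      rw [quatDC_eq]; simp
    rw [h1, mul_one, mul_smul_comm, mul_one] at this
    rw [neg_smul]
    exact eq_neg_of_add_eq_zero_left this
  have h2 : q * (tz • 1 + tw • quatI lam) = 0 := by
    have hi := h (quatI lam)
    have h1' : quatDC lam (quatI lam) = (-tz) • 1 := by
      rw [quatDC_eq]; simp [quatI]
    rw [h1', h1] at hi
    rw [← neg_eq_zero, ← hi]
    simp only [mul_add, mul_smul_comm, smul_mul_assoc, mul_one]
    module
  have h3 := mul_quatConj lam q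
  rw [h2, zero_mul] at h3
  have h4 : q = 0 := (smul_eq_zero.mp h3.symm).resolve_left (tz_sq_add_ne_zero lam)
  exact ⟨by rw [h1, h4, smul_zero], h4⟩

theorem exists_smul_eq_of_smul_eq (lam : ℂ) (p q : H lam)
    (h : (ty ^ 2 + tw ^ 3) • p = (tz ^ 2 + tw ^ 2 * tu lam) • q) :
    ∃ v, p = (tz ^ 2 + tw ^ 2 * tu lam) • v := by
  obtain ⟨a, ha⟩ := dvd_of_dvd_mul lam ⟨_, congrArg QuaternionAlgebra.re h⟩
  obtain ⟨b, hb⟩ := dvd_of_dvd_mul lam ⟨_, congrArg QuaternionAlgebra.imI h⟩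
  obtain ⟨c, hc⟩ := dvd_of_dvd_mul lam ⟨_, congrArg QuaternionAlgebra.imJ h⟩
  obtain ⟨d, hd⟩ := dvd_of_dvd_mul lam ⟨_, congrArg QuaternionAlgebra.imK h⟩
  exact ⟨⟨a, b, c, d⟩, QuaternionAlgebra.ext ha hb hc hd⟩

set_option maxHeartbeats 1000000 in
/-- An endomorphism of the quaternion algebra that commutes with right multiplication by `x`
and vanishes at `1` is a left multiple of `d c - w`. -/
theorem exists_eq_mul_quatDC_sub (lam : ℂ) (G : H lam →ₗ[T] H lam)
    (hG : ∀ v, G (v * quatX lam) = G v * quatX lam) (h1 : G 1 = 0) :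
    ∃ q, ∀ v, G v = q * (quatDC lam v - tw • v) := by
  set p := G (quatI lam) with hp
  set q := G (quatJ lam) with hq
  set r := G (quatK lam) with hr
  have hsum (v : H lam) : G v = v.imI • p + v.imJ • q + v.imK • r := by
    conv_lhs => rw [quat_eq_sum lam v]
    simp [h1, hp, hq, hr]
  -- This is G(X) = G(1)X = 0.
  have e1 : tw • r = ty • p + tz • q := by
    have := hG 1
    rw [h1, zero_mul, one_mul, hsum] at this
    simp only [quatX] at this
    linear_combination (norm := module) -this
  -- This is G(iX) = G(i)X, expanded with iX = -uy + wuj + zk.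
  have e2 : p * quatX lam = tz • r + (tw * tu lam) • q := by
    rw [hp, ← hG, hsum]
    simp [quatX, quatI]
    module
  -- Eliminating r from w·e2 by e1 gives p(zy - wX) = -(z² + w²u)q, and zy - wX factors.
  have e3 : p * (tz • 1 - tw • quatI lam) * (ty • 1 - tw • quatJ lam) =
      -((tz ^ 2 + tw ^ 2 * tu lam) • q) := by
    have : (tz • 1 - tw • quatI lam) * (ty • 1 - tw • quatJ lam) =
        (tz * ty) • 1 - tw • quatX lam := by
      ext1 <;> simp [quatI, quatJ, quatX]; ring
    rw [mul_assoc, this, mul_sub, mul_smul_comm, mul_smul_comm, e2, mul_one]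
    linear_combination (norm := module) -tz • e1
  -- Multiplying e3 on the right by y + wj turns the factor y - wj into its norm y² + w³, so z² +
  -- w²u divides p(z - wi). The quotient v then determines p, q and r.
  obtain ⟨v, hv⟩ := exists_smul_eq_of_smul_eq lam (p * (tz • 1 - tw • quatI lam))
    (-(q * (ty • 1 + tw • quatJ lam))) (by
      rw [← mul_quatConjJ, e3]
      simp)
  have hpv : p = v * (tz • 1 + tw • quatI lam) := by
    have := mul_quatConj' lam p
    rw [hv, smul_mul_assoc] at this
    exact (smul_right_injective _ (tz_sq_add_ne_zero lam) this).symm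
  have hqv : q = -(v * (ty • 1 - tw • quatJ lam)) := by
    rw [hv, smul_mul_assoc, ← smul_neg] at e3
    rw [smul_right_injective _ (tz_sq_add_ne_zero lam) e3, neg_neg]
  have hrv : r = v * (ty • quatI lam + tz • quatJ lam) := by
    refine smul_right_injective _ tw_ne_zero ?_
    change tw • r = tw • _
    rw [e1, hpv, hqv]
    simp only [mul_add, mul_sub, mul_smul_comm, mul_one]
    module
  -- The sign: dc(h) - wh = -(imI·(z + wi) - imJ·(y - wj) + imK·(yi + zj)).
  refine ⟨-v, fun h => ?_⟩
  rw [hsum, hpv, hqv, hrv, ← mul_neg, ← mul_smul_comm, ← mul_smul_comm, ← mul_smul_comm, ← mul_add,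
    ← mul_add, neg_mul, ← mul_neg]
  congr 1
  rw [quatDC_eq]
  ext1 <;> simp [quatI, quatJ, quatX] <;> ring

theorem exists_eq_mul_add_mul_quatDC (lam : ℂ) (F : H lam →ₗ[T] H lam)
    (hF : ∀ v, F (v * quatX lam) = F v * quatX lam) :
    ∃ p q, ∀ v, F v = p * v + q * quatDC lam v := by
  obtain ⟨q, hq⟩ := exists_eq_mul_quatDC_sub lam (F - LinearMap.mulLeft T (F 1))
    (fun v => by simp [hF, sub_mul, mul_assoc]) (by simp)
  refine ⟨F 1 - tw • q, q, fun v => ?_⟩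
  have := hq v
  rw [LinearMap.sub_apply, LinearMap.mulLeft_apply, sub_eq_iff_eq_add] at this
  rw [this, mul_sub, sub_mul, mul_smul_comm, smul_mul_assoc]
  abel

end MorrisonPinkham

/-! ### Algebras generated by elements satisfying the relations -/

namespace MorrisonPinkham

open MvPolynomial

/-- Elements of an algebra that generate it and satisfy the relations of the quiver. -/
structure Generators (lam : ℂ) (B : Type) [Ring B] [Algebra ℂ B] where
  (eR eM a b c d : B)
  add_eq_one : eR + eM = 1
  a_eR : a * eR = 0
  eR_a : eR * a = 0
  b_eR : b * eR = 0
  eR_b : eR * b = 0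
  c_eR : c * eR = 0
  eR_c : eR * c = c
  d_eR : d * eR = d
  eR_d : eR * d = 0
  relC : b * b * d + d * c * d = 0
  relD : c * b * b + c * d * c = 0
  relA : a * b + b * a = 0
  relB : a * a + b * d * c + d * c * b + algebraMap ℂ B lam * b * b + b * b * b = 0
  span_eq_top : ∀ V : Submodule ℂ B, eR ∈ V → eM ∈ V →
    (∀ v ∈ V, a * v ∈ V ∧ b * v ∈ V ∧ c * v ∈ V ∧ d * v ∈ V) → V = ⊤

namespace Generators

variable {lam : ℂ} {B : Type} [Ring B] [Algebra ℂ B] (J : Generators lam B)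

theorem eM_eq : J.eM = 1 - J.eR := eq_sub_of_add_eq' J.add_eq_one

theorem d_a : J.d * J.a = 0 := by rw [← J.d_eR, mul_assoc, J.eR_a, mul_zero]
theorem d_b : J.d * J.b = 0 := by rw [← J.d_eR, mul_assoc, J.eR_b, mul_zero]
theorem d_d : J.d * J.d = 0 := by
  conv_lhs => enter [1]; rw [← J.d_eR]
  rw [mul_assoc, J.eR_d, mul_zero]
theorem a_c : J.a * J.c = 0 := by rw [← J.eR_c, ← mul_assoc, J.a_eR, zero_mul]
theorem b_c : J.b * J.c = 0 := by rw [← J.eR_c, ← mul_assoc, J.b_eR, zero_mul]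
theorem c_c : J.c * J.c = 0 := by
  conv_lhs => enter [2]; rw [← J.eR_c]
  rw [← mul_assoc, J.c_eR, zero_mul]

theorem a_b_b : J.a * J.b * J.b = J.b * J.b * J.a := by
  linear_combination (norm := noncomm_ring) J.relA * J.b - J.b * J.relA

/-- The central elements that become `w`, `y` and `z`. -/
def cW : B := J.c * J.d - J.b * J.b

def cY : B := J.c * J.b * J.d + J.b * J.d * J.c + J.d * J.c * J.b + J.b * J.b * J.b

def cZ : B := -(J.c * J.a * J.d + J.a * J.d * J.c + J.d * J.c * J.a + J.a * J.b * J.b)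

/-- The elements commuting with u form a subspace containing both vertices and stable under left
multiplication by the arrows, so `span_eq_top` applies. -/
theorem commute_of_commute {u : B} (hR : u * J.eR = J.eR * u) (ha : u * J.a = J.a * u)
    (hb : u * J.b = J.b * u) (hc : u * J.c = J.c * u) (hd : u * J.d = J.d * u) :
    u ∈ Subalgebra.center ℂ B := by
  have h := J.span_eq_top (LinearMap.ker (LinearMap.mulLeft ℂ u - LinearMap.mulRight ℂ u))
    (by simp [hR]) (by simp [J.eM_eq, mul_sub, sub_mul, hR]) (by
      intro v hv
      simp only [LinearMap.mem_ker, LinearMap.sub_apply, LinearMap.mulLeft_apply,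
        LinearMap.mulRight_apply, sub_eq_zero] at hv ⊢
      refine ⟨?_, ?_, ?_, ?_⟩
      · rw [← mul_assoc, ha, mul_assoc, hv, mul_assoc]
      · rw [← mul_assoc, hb, mul_assoc, hv, mul_assoc]
      · rw [← mul_assoc, hc, mul_assoc, hv, mul_assoc]
      · rw [← mul_assoc, hd, mul_assoc, hv, mul_assoc])
  rw [Subalgebra.mem_center_iff]
  intro v
  have hv : v ∈ LinearMap.ker (LinearMap.mulLeft ℂ u - LinearMap.mulRight ℂ u) := by
    rw [h]; trivial
  simp only [LinearMap.mem_ker, LinearMap.sub_apply, LinearMap.mulLeft_apply,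
    LinearMap.mulRight_apply, sub_eq_zero] at hv
  exact hv.symm

theorem cW_mem_center : J.cW ∈ Subalgebra.center ℂ B := by
  apply J.commute_of_commute <;> rw [cW]
  · linear_combination (norm := noncomm_ring) J.c * J.d_eR - J.b * J.b_eR - J.eR_c * J.d +
      J.eR_b * J.b
  · linear_combination (norm := noncomm_ring) J.c * J.d_a - J.a_c * J.d + J.relA * J.b -
      J.b * J.relA
  · linear_combination (norm := noncomm_ring) J.c * J.d_b - J.b_c * J.d
  · linear_combination (norm := noncomm_ring) J.relD - J.b * J.b_c - J.c_c * J.d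
  · linear_combination (norm := noncomm_ring) J.c * J.d_d - J.relC + J.d_b * J.b

theorem algebraMap_mul (v : B) : algebraMap ℂ B lam * v = v * algebraMap ℂ B lam :=
  Algebra.commutes lam v

/-- The part of `cY` at M is -(a² + λb²) by `relB`, which commutes with a because b² does.
Commutation with b, c and d comes from `relC` and `relD`. -/
theorem cY_mem_center : J.cY ∈ Subalgebra.center ℂ B := by
  apply J.commute_of_commute <;> rw [cY]
  · linear_combination (norm := noncomm_ring) J.c * J.b * J.d_eR + J.b * J.d * J.c_eR +
      J.d * J.c * J.b_eR + J.b * J.b * J.b_eR - J.eR_c * J.b * J.d - J.eR_b * J.d * J.c -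
      J.eR_d * J.c * J.b - J.eR_b * J.b * J.b
  · linear_combination (norm := noncomm_ring) J.c * J.b * J.d_a - J.a_c * J.b * J.d +
      J.relB * J.a - J.a * J.relB + algebraMap ℂ B lam * J.a_b_b -
      algebraMap_mul (lam := lam) J.a * J.b * J.b
  · linear_combination (norm := noncomm_ring) J.c * J.b * J.d_b - J.b_c * J.b * J.d +
      J.d * J.relD - J.relC * J.c
  · linear_combination (norm := noncomm_ring) J.b * J.d * J.c_c + J.d * J.c * J.b_c +
      J.b * J.b * J.b_c - J.c_c * J.b * J.d - J.relD * J.b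
  · linear_combination (norm := noncomm_ring) J.c * J.b * J.d_d + J.b * J.relC -
      J.d_b * J.d * J.c - J.d_d * J.c * J.b - J.d_b * J.b * J.b

/-- Both sides equal -dcdc. -/
theorem d_c_b_b : J.d * J.c * J.b * J.b = J.b * J.b * J.d * J.c := by
  linear_combination (norm := noncomm_ring) J.d * J.relD - J.relC * J.c

/-- By `relB`, a² is -(bdc + dcb + λb² + b³). Here dc commutes with b², and the remaining terms
reduce on both sides to dcbdc because dcdcb + dcb³ = 0 and bdcdc + b³dc = 0. -/
theorem d_c_a_a : J.d * J.c * J.a * J.a = J.a * J.a * J.d * J.c := by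
  linear_combination (norm := noncomm_ring) J.d * J.c * J.relB - J.relB * J.d * J.c -
    J.d * J.relD * J.b + J.b * J.relC * J.c - algebraMap ℂ B lam * J.d_c_b_b +
    algebraMap_mul (lam := lam) (J.d * J.c) * J.b * J.b

theorem cZ_mem_center : J.cZ ∈ Subalgebra.center ℂ B := by
  apply Subalgebra.neg_mem
  apply J.commute_of_commute
  · linear_combination (norm := noncomm_ring) J.c * J.a * J.d_eR + J.a * J.d * J.c_eR +
      J.d * J.c * J.a_eR + J.a * J.b * J.b_eR - J.eR_c * J.a * J.d - J.eR_a * J.d * J.c -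
      J.eR_d * J.c * J.a - J.eR_a * J.b * J.b
  · linear_combination (norm := noncomm_ring) J.c * J.a * J.d_a - J.a_c * J.a * J.d +
      J.d_c_a_a - J.a * J.a_b_b
  · linear_combination (norm := noncomm_ring) J.c * J.a * J.d_b - J.b_c * J.a * J.d +
      J.a * J.relB - J.relB * J.a - algebraMap ℂ B lam * J.a_b_b + J.b * J.b * J.relA +
      J.a_b_b * J.b - J.relA * J.b * J.b + J.d * J.c * J.relA - J.relA * J.d * J.c +
      algebraMap_mul (lam := lam) J.a * J.b * J.b
  · linear_combination (norm := noncomm_ring) J.a * J.d * J.c_c + J.d * J.c * J.a_c +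
      J.a * J.b * J.b_c - J.c_c * J.a * J.d - J.relD * J.a - J.c * J.a_b_b
  · linear_combination (norm := noncomm_ring) J.c * J.a * J.d_d + J.a * J.relC -
      J.d_a * J.d * J.c - J.d_d * J.c * J.a - J.d_a * J.b * J.b

/-- The central action of `ℂ[z, w, y]`. -/
noncomputable def centralHom : T →ₐ[ℂ] Subalgebra.center ℂ B :=
  aeval ![⟨J.cZ, J.cZ_mem_center⟩, ⟨J.cW, J.cW_mem_center⟩, ⟨J.cY, J.cY_mem_center⟩]

/-- The structure of an algebra over `ℂ[z, w, y]`. -/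
noncomputable abbrev algebra : Algebra T B :=
  ((Subalgebra.center ℂ B).val.toRingHom.comp J.centralHom.toRingHom).toAlgebra'
    fun t v => (Subalgebra.mem_center_iff.mp (J.centralHom t).2 v).symm

theorem algebraMap_X_zero : J.algebra.algebraMap tz = J.cZ := by
  change (J.centralHom tz : B) = _
  simp [centralHom]

theorem algebraMap_X_one : J.algebra.algebraMap tw = J.cW := by
  change (J.centralHom tw : B) = _
  simp [centralHom]

theorem algebraMap_X_two : J.algebra.algebraMap ty = J.cY := by
  change (J.centralHom ty : B) = _
  simp [centralHom]

theorem algebraMap_C (r : ℂ) : J.algebra.algebraMap (C r) = algebraMap ℂ B r := by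
  change (J.centralHom (C r) : B) = _
  simp [centralHom]

end Generators

/-- The relations between the generators over the central subalgebra `ℂ[z, w, y]`. -/
structure CentralRelations (lam : ℂ) {B : Type} [Ring B] [Algebra T B] (eR eM a b c d : B) :
    Prop where
  a_eR : a * eR = 0
  b_eR : b * eR = 0
  c_eR : c * eR = 0
  d_eR : d * eR = d
  a_eM : a * eM = a
  b_eM : b * eM = b
  c_eM : c * eM = c
  eM_b : eM * b = b
  eR_c : eR * c = c
  eM_d : eM * d = d
  d_eM : d * eM = 0
  d_a : d * a = 0
  d_b : d * b = 0
  a_c : a * c = 0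
  b_c : b * c = 0
  c_c : c * c = 0
  c_d : c * d = tw • eR
  c_a_d : c * a * d = -tz • eR
  c_b_d : c * b * d = ty • eR
  b_b : b * b = -tw • eM
  a_a : a * a = -tu lam • eM
  b_a : b * a = -(a * b)
  d_c_a : d * c * a = -(a * d * c) - tz • eM + tw • a
  d_c_b : d * c * b = -(b * d * c) + ty • eM + tw • b

/-- Multiplying `cW`, `cY`, `cZ` by eR keeps only the cycles cd, cbd, -cad at R; multiplying by eM
keeps only those at M. Thus `relB` becomes a² = -u on M, and the definitions of `cY` and `cZ` become
rules for moving dc to the right past b and a. -/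
theorem Generators.centralRelations {lam : ℂ} {B : Type} [Ring B] [Algebra ℂ B]
    (J : Generators lam B) :
    letI := J.algebra
    CentralRelations lam J.eR J.eM J.a J.b J.c J.d := by
  let := J.algebra
  have hz (v : B) : tz • v = J.cZ * v := by
    rw [Algebra.smul_def]; exact congrArg (· * v) J.algebraMap_X_zero
  have hw (v : B) : tw • v = J.cW * v := by
    rw [Algebra.smul_def]; exact congrArg (· * v) J.algebraMap_X_one
  have hy (v : B) : ty • v = J.cY * v := by
    rw [Algebra.smul_def]; exact congrArg (· * v) J.algebraMap_X_two
  have hC (v : B) : (C lam : T) • v = algebraMap ℂ B lam * v := by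
    rw [Algebra.smul_def]; exact congrArg (· * v) (J.algebraMap_C lam)
  have hM := J.eM_eq
  refine
    { a_eR := J.a_eR
      b_eR := J.b_eR
      c_eR := J.c_eR
      d_eR := J.d_eR
      a_eM := by rw [hM, mul_sub, mul_one, J.a_eR, sub_zero]
      b_eM := by rw [hM, mul_sub, mul_one, J.b_eR, sub_zero]
      c_eM := by rw [hM, mul_sub, mul_one, J.c_eR, sub_zero]
      eM_b := by rw [hM, sub_mul, one_mul, J.eR_b, sub_zero]
      eR_c := J.eR_c
      eM_d := by rw [hM, sub_mul, one_mul, J.eR_d, sub_zero]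
      d_eM := by rw [hM, mul_sub, mul_one, J.d_eR, sub_self]
      d_a := J.d_a
      d_b := J.d_b
      a_c := J.a_c
      b_c := J.b_c
      c_c := J.c_c
      c_d := ?_
      c_a_d := ?_
      c_b_d := ?_
      b_b := ?_
      a_a := ?_
      b_a := eq_neg_of_add_eq_zero_right J.relA
      d_c_a := ?_
      d_c_b := ?_ }
  · rw [hw, Generators.cW]
    linear_combination (norm := noncomm_ring) -J.c * J.d_eR + J.b * J.b_eR
  · rw [neg_smul, hz, Generators.cZ]
    linear_combination (norm := noncomm_ring) -J.c * J.a * J.d_eR - J.a * J.d * J.c_eR -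
      J.d * J.c * J.a_eR - J.a * J.b * J.b_eR
  · rw [hy, Generators.cY]
    linear_combination (norm := noncomm_ring) -J.c * J.b * J.d_eR - J.b * J.d * J.c_eR -
      J.d * J.c * J.b_eR - J.b * J.b * J.b_eR
  · rw [neg_smul, hw, Generators.cW, hM]
    linear_combination (norm := noncomm_ring) -J.c * J.d_eR + J.b * J.b_eR
  · rw [neg_smul, sub_smul, mul_smul, hy, hw, hC, Generators.cY, Generators.cW, hM]
    linear_combination (norm := noncomm_ring) J.relB - J.c * J.b * J.d_eR - J.b * J.d * J.c_eR -
      J.d * J.c * J.b_eR - J.b * J.b * J.b_eR + algebraMap ℂ B lam * J.c * J.d_eR -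
      algebraMap ℂ B lam * J.b * J.b_eR
  · rw [hz, hw, Generators.cZ, Generators.cW, hM]
    linear_combination (norm := noncomm_ring) J.c * J.a * J.d_eR + J.a * J.d * J.c_eR +
      J.d * J.c * J.a_eR + J.a * J.b * J.b_eR - J.c * J.d_a - J.a_b_b
  · rw [hy, hw, Generators.cY, Generators.cW, hM]
    linear_combination (norm := noncomm_ring) J.c * J.b * J.d_eR + J.b * J.d * J.c_eR +
      J.d * J.c * J.b_eR + J.b * J.b * J.b_eR - J.c * J.d_b

/-- The image of a quaternion under `i ↦ a`, `j ↦ b`. -/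
noncomputable def quatEval {lam : ℂ} {B : Type} [Ring B] [Algebra T B] (e a b : B) : H lam →ₗ[T] B where
  toFun h := h.re • e + h.imI • a + h.imJ • b + h.imK • (a * b)
  map_add' h h' := by
    simp only [QuaternionAlgebra.re_add, QuaternionAlgebra.imI_add, QuaternionAlgebra.imJ_add,
      QuaternionAlgebra.imK_add]
    module
  map_smul' t h := by
    simp only [QuaternionAlgebra.re_smul, QuaternionAlgebra.imI_smul, QuaternionAlgebra.imJ_smul,
      QuaternionAlgebra.imK_smul, RingHom.id_apply, smul_eq_mul]
    module

theorem quatEval_apply {lam : ℂ} {B : Type} [Ring B] [Algebra T B] (e a b : B) (h : H lam) :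
    quatEval e a b h = h.re • e + h.imI • a + h.imJ • b + h.imK • (a * b) := rfl

/-- The normal form of an element, with coefficients in `ℂ[z, w, y]`. -/
noncomputable def normalForm {lam : ℂ} {B : Type} [Ring B] [Algebra T B] (eR eM a b c d : B) (s t : T)
    (p q h k : H lam) : B :=
  s • eR + t • (c * a * b * d) + quatEval eM a b p * d + c * quatEval eM a b q +
    quatEval eM a b h + quatEval eM a b k * d * c

/-! ### Left multiplication by the arrows on normal forms -/

namespace CentralRelations

variable {lam : ℂ} {B : Type} [Ring B] [Algebra T B] {eR eM a b c d : B}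

theorem a_mul_quatEval (K : CentralRelations lam eR eM a b c d) (h : H lam) :
    a * quatEval eM a b h = quatEval eM a b (quatI lam * h) := by
  simp only [quatEval_apply, mul_add, mul_smul_comm, ← mul_assoc, K.a_eM, K.a_a, smul_mul_assoc,
    K.eM_b]
  simp [quatI]
  module

theorem b_mul_quatEval (K : CentralRelations lam eR eM a b c d) (h : H lam) :
    b * quatEval eM a b h = quatEval eM a b (quatJ lam * h) := by
  have hbab : b * a * b = tw • a := by
    rw [K.b_a, neg_mul, mul_assoc, K.b_b, mul_smul_comm, K.a_eM, neg_smul, neg_neg]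
  simp only [quatEval_apply, mul_add, mul_smul_comm, ← mul_assoc, K.b_eM, K.b_b, hbab]
  rw [K.b_a]
  simp [quatJ]
  module

theorem d_mul_quatEval (K : CentralRelations lam eR eM a b c d) (h : H lam) :
    d * quatEval eM a b h = 0 := by
  simp only [quatEval_apply, mul_add, mul_smul_comm, ← mul_assoc, K.d_eM, K.d_a, K.d_b, zero_mul,
    smul_zero, add_zero]

theorem c_mul_quatEval_mul_d (K : CentralRelations lam eR eM a b c d) (h : H lam) :
    c * quatEval eM a b h * d =
      (tw * h.re - tz * h.imI + ty * h.imJ) • eR + h.imK • (c * a * b * d) := by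
  simp only [quatEval_apply, mul_add, mul_smul_comm, add_mul, smul_mul_assoc, K.c_eM, K.c_d,
    K.c_a_d, K.c_b_d, ← mul_assoc]
  module

theorem d_c_a_b (K : CentralRelations lam eR eM a b c d) :
    d * c * a * b = a * b * d * c - ty • a - tz • b := by
  have h : a * d * c * b = -(a * b * d * c) + ty • a + tw • (a * b) := by
    rw [mul_assoc a, mul_assoc a, K.d_c_b]
    simp only [mul_add, mul_neg, mul_smul_comm, ← mul_assoc, K.a_eM]
  rw [K.d_c_a]
  simp only [add_mul, sub_mul, neg_mul, smul_mul_assoc, K.eM_b, h]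
  module

/-- Moving dc past i or j changes the sign, and past k = ij it does not; the second summand collects
the corrections without dc. -/
theorem d_mul_c_mul_quatEval (K : CentralRelations lam eR eM a b c d) (h : H lam) :
    d * c * quatEval eM a b h =
      quatEval eM a b (⟨h.re, -h.imI, -h.imJ, h.imK⟩ : H lam) * d * c +
      quatEval eM a b (⟨-(tz * h.imI) + ty * h.imJ, tw * h.imI - ty * h.imK,
        tw * h.imJ - tz * h.imK, 0⟩ : H lam) := by
  have hd : d * c * eM = d * c := by rw [mul_assoc, K.c_eM]
  simp only [quatEval_apply, mul_add, mul_smul_comm, ← mul_assoc, hd, K.d_c_a_b, add_mul,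
    smul_mul_assoc, K.eM_d]
  rw [K.d_c_a, K.d_c_b]
  module

/-- Moving dc back to the left of ab produces cdcab, and cd = w at R removes the cycle. -/
theorem c_a_b_d_c (K : CentralRelations lam eR eM a b c d) :
    c * a * b * d * c = c * quatEval eM a b (⟨0, ty, tz, tw⟩ : H lam) := by
  have h : a * b * d * c = d * c * a * b + ty • a + tz • b := by
    rw [K.d_c_a_b]; abel
  have h' : c * a * b * d * c = c * (a * b * d * c) := by simp only [mul_assoc]
  have h'' : c * d * c * a * b = tw • (c * a * b) := by
    rw [K.c_d, smul_mul_assoc, K.eR_c, smul_mul_assoc, smul_mul_assoc]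
  rw [h', h, quatEval_apply]
  simp only [mul_add, mul_smul_comm, ← mul_assoc, h'']
  module

theorem d_c_a_b_d (K : CentralRelations lam eR eM a b c d) :
    d * c * a * b * d = quatEval eM a b (⟨0, -ty, -tz, tw⟩ : H lam) * d := by
  have h : a * b * d * c * d = tw • (a * b * d) := by
    rw [mul_assoc _ c, K.c_d, mul_smul_comm, mul_assoc _ d, K.d_eR]
  rw [K.d_c_a_b, quatEval_apply]
  simp only [sub_mul, add_mul, smul_mul_assoc, h, K.eM_d]
  module

theorem a_mul_normalForm (K : CentralRelations lam eR eM a b c d) (s t : T) (p q h k : H lam) :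
    a * normalForm eR eM a b c d s t p q h k =
      normalForm eR eM a b c d 0 0 (quatI lam * p) 0 (quatI lam * h) (quatI lam * k) := by
  simp only [normalForm, mul_add, mul_smul_comm, ← mul_assoc, K.a_mul_quatEval, K.a_eR, K.a_c,
    zero_mul, smul_zero, zero_smul, map_zero, mul_zero, zero_add, add_zero]

theorem b_mul_normalForm (K : CentralRelations lam eR eM a b c d) (s t : T) (p q h k : H lam) :
    b * normalForm eR eM a b c d s t p q h k =
      normalForm eR eM a b c d 0 0 (quatJ lam * p) 0 (quatJ lam * h) (quatJ lam * k) := by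
  simp only [normalForm, mul_add, mul_smul_comm, ← mul_assoc, K.b_mul_quatEval, K.b_eR, K.b_c,
    zero_mul, smul_zero, zero_smul, map_zero, mul_zero, zero_add, add_zero]

theorem c_mul_normalForm (K : CentralRelations lam eR eM a b c d) (s t : T) (p q h k : H lam) :
    c * normalForm eR eM a b c d s t p q h k =
      normalForm eR eM a b c d (tw * p.re - tz * p.imI + ty * p.imJ) p.imK 0
        (h + (tw * k.re - tz * k.imI + ty * k.imJ) • 1 +
          k.imK • (⟨0, ty, tz, tw⟩ : H lam)) 0 0 := by
  have h1 : c * quatEval eM a b (1 : H lam) = c := by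
    rw [quatEval_apply]
    simp [K.c_eM]
  simp only [normalForm, mul_add, mul_smul_comm, ← mul_assoc, K.c_eR, K.c_c,
    K.c_mul_quatEval_mul_d, add_mul, smul_mul_assoc, K.eR_c, K.c_a_b_d_c, map_add, map_smul, h1,
    zero_mul, smul_zero, map_zero, zero_add, add_zero]
  abel

theorem d_mul_normalForm (K : CentralRelations lam eR eM a b c d) (s t : T) (p q h k : H lam) :
    d * normalForm eR eM a b c d s t p q h k =
      normalForm eR eM a b c d 0 0 (s • 1 + t • (⟨0, -ty, -tz, tw⟩ : H lam)) 0
        (⟨-(tz * q.imI) + ty * q.imJ, tw * q.imI - ty * q.imK, tw * q.imJ - tz * q.imK, 0⟩ : H lam)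
        (⟨q.re, -q.imI, -q.imJ, q.imK⟩ : H lam) := by
  have h1 : quatEval eM a b (1 : H lam) * d = d := by
    rw [quatEval_apply]
    simp [K.eM_d]
  simp only [normalForm, mul_add, mul_smul_comm, ← mul_assoc, K.d_eR, K.d_mul_quatEval,
    K.d_mul_c_mul_quatEval, add_mul, smul_mul_assoc, K.d_c_a_b_d, map_add, map_smul, h1,
    zero_mul, zero_smul, map_zero, mul_zero, zero_add, add_zero]
  abel

end CentralRelations

theorem Generators.exists_eq_normalForm {lam : ℂ} {B : Type} [Ring B] [Algebra ℂ B]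
    (J : Generators lam B) (v : B) :
    letI := J.algebra
    ∃ (s t : T) (p q h k : H lam), v = normalForm J.eR J.eM J.a J.b J.c J.d s t p q h k := by
  let := J.algebra
  have K := J.centralRelations
  let V : Submodule ℂ B :=
    { carrier := {v | ∃ (s t : T) (p q h k : H lam),
        v = normalForm J.eR J.eM J.a J.b J.c J.d s t p q h k}
      zero_mem' := ⟨0, 0, 0, 0, 0, 0, by simp [normalForm]⟩
      add_mem' := by
        rintro _ _ ⟨s, t, p, q, h, k, rfl⟩ ⟨s', t', p', q', h', k', rfl⟩
        refine ⟨s + s', t + t', p + p', q + q', h + h', k + k', ?_⟩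
        simp only [normalForm, map_add, add_smul, add_mul, mul_add]
        abel
      smul_mem' := by
        rintro r _ ⟨s, t, p, q, h, k, rfl⟩
        let r' : T := C r
        refine ⟨r' * s, r' * t, r' • p, r' • q, r' • h, r' • k, ?_⟩
        have hr (v : B) : r • v = r' • v := by
          rw [Algebra.smul_def, Algebra.smul_def]
          exact congrArg (· * v) (J.algebraMap_C r).symm
        rw [hr]
        simp only [normalForm, map_smul, mul_smul, smul_mul_assoc, mul_smul_comm, smul_add] }
  have hV : V = ⊤ := by
    refine J.span_eq_top V ⟨1, 0, 0, 0, 0, 0, by simp [normalForm]⟩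
      ⟨0, 0, 0, 0, 1, 0, by simp [normalForm, quatEval_apply]⟩ ?_
    rintro _ ⟨s, t, p, q, h, k, rfl⟩
    exact ⟨⟨_, _, _, _, _, _, K.a_mul_normalForm s t p q h k⟩,
      ⟨_, _, _, _, _, _, K.b_mul_normalForm s t p q h k⟩,
      ⟨_, _, _, _, _, _, K.c_mul_normalForm s t p q h k⟩,
      ⟨_, _, _, _, _, _, K.d_mul_normalForm s t p q h k⟩⟩
  have hv : v ∈ V := by rw [hV]; trivial
  exact hv

end MorrisonPinkham

/-! ### Homomorphisms between `R` and `M` -/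

namespace MorrisonPinkham

open MvPolynomial

theorem mapD_one (lam : ℂ) : mapD lam 1 = quatToM lam 1 := by
  rw [quatToM_one, mapD, LinearMap.toSpanSingleton_apply, one_smul]
  rfl

theorem mapC_quatToM (lam : ℂ) (h : H lam) :
    mapC lam (quatToM lam h) =
      incl lam (tw * h.re - tz * h.imI + ty * h.imJ) + incl lam (-h.imK) * toR lam x := by
  simp only [quatToM_apply, map_add, map_sub, map_smul, mapC_basisM, smul_eq_mul, Phi,
    Matrix.cons_val, Matrix.of_apply, map_neg, map_mul, incl_tw, incl_ty, incl_tz]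
  ring

theorem mapD_mapC_quatToM (lam : ℂ) (h : H lam) :
    mapD lam (mapC lam (quatToM lam h)) = quatToM lam (quatDC lam h) := by
  have hd (r : R lam) : mapD lam r = r • quatToM lam 1 := by
    rw [← mapD_one, ← map_smul, smul_eq_mul, mul_one]
  rw [hd, mapC_quatToM, quatDC_eq, sub_eq_add_neg (_ • (1 : H lam)), ← neg_smul, map_add (quatToM lam),
    quatToM_smul, quatToM_smul, add_smul, mul_smul, ← quatToM_mul_quatX, one_mul]

/-- The x-coefficient of c(qv) is -imK(qv); at v = k, j, i, 1 it recovers the components of q up to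
sign. -/
theorem mapC_quatToM_eq_zero (lam : ℂ) (q : H lam)
    (hq : ∀ v, mapC lam (quatToM lam (q * v)) = 0) : q = 0 := by
  have h (v : H lam) : (q * v).imK = 0 := by
    have h := hq v
    rw [mapC_quatToM] at h
    have := (coords_unique lam (s' := 0) (t' := 0) (by rw [h, map_zero]; ring)).2
    exact neg_eq_zero.mp this
  ext1
  · simpa [quatK] using h (quatK lam)
  · simpa [quatJ] using h (quatJ lam)
  · simpa [quatI] using h (quatI lam)
  · simpa using h 1

theorem exists_eq_mapC_mul (lam : ℂ) (g : M lam →ₗ[R lam] R lam) :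
    ∃ q : H lam, ∀ v, g (quatToM lam v) = mapC lam (quatToM lam (q * v)) := by
  choose s t hst using fun v : H lam => exists_coords lam (g (quatToM lam v))
  -- The x-coefficient t of g is `T`-linear because coordinates in R are unique.
  have ht (v : H lam) : t v = v.re * t 1 + v.imI * t (quatI lam) + v.imJ * t (quatJ lam) +
      v.imK * t (quatK lam) := by
    refine (coords_unique lam (s := s v) (s' := v.re * s 1 + v.imI * s (quatI lam) +
      v.imJ * s (quatJ lam) + v.imK * s (quatK lam)) ?_).2
    rw [← hst]
    conv_lhs => rw [quat_eq_sum lam v]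
    simp only [map_add, quatToM_smul]
    simp only [g.map_smul, smul_eq_mul, hst, map_mul]
    ring
  -- Comparing x-coefficients in g(vX) = x·g(v) shows that t determines g.
  have hs (v : H lam) : s v = t (v * quatX lam) := by
    refine (coords_unique lam (s := xSq lam * t v) (s' := s (v * quatX lam)) ?_).2
    rw [← hst, quatToM_mul_quatX, g.map_smul, smul_eq_mul, hst, map_mul, ← toR_x_sq]
    ring
  -- The components of q solve -imK(qv) = t(v) for v = k, j, i, 1.
  refine ⟨⟨-t (quatK lam), -t (quatJ lam), t (quatI lam), -t 1⟩, fun v => ?_⟩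
  rw [hst, mapC_quatToM, hs, ht, ht v]
  congr 2
  · simp [quatX]
    ring
  · congr 1
    simp
    ring

/-- The endomorphism of `M` given by left multiplication by a quaternion. -/
noncomputable def quatEnd (lam : ℂ) (h : H lam) : M lam →ₗ[R lam] M lam :=
  incl lam h.re • LinearMap.id + incl lam h.imI • loopA lam + incl lam h.imJ • loopB lam +
    incl lam h.imK • (loopA lam ∘ₗ loopB lam)

theorem quatEnd_quatToM (lam : ℂ) (h v : H lam) :
    quatEnd lam h (quatToM lam v) = quatToM lam (h * v) := by
  have hh : h * v = h.re • v + h.imI • (quatI lam * v) + h.imJ • (quatJ lam * v) +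
      h.imK • (quatI lam * (quatJ lam * v)) := by
    ext1 <;> simp [quatI, quatJ] <;> ring
  rw [hh]
  simp only [map_add, quatToM_smul, quatToM_quatI_mul, quatToM_quatJ_mul]
  rfl

theorem exists_eq_quatEnd_add (lam : ℂ) (g : M lam →ₗ[R lam] M lam) :
    ∃ p q : H lam, ∀ v, g (quatToM lam v) = quatToM lam (p * v + q * quatDC lam v) := by
  choose F hF using fun v : H lam => quatToM_surjective lam (g (quatToM lam v))
  let F' : H lam →ₗ[T] H lam :=
    { toFun := F
      map_add' := fun v v' => quatToM_injective lam (by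
        rw [map_add, hF, hF, hF, map_add, map_add])
      map_smul' := fun t v => quatToM_injective lam (by
        rw [RingHom.id_apply, quatToM_smul, hF, hF, quatToM_smul, map_smul]) }
  obtain ⟨p, q, h⟩ := exists_eq_mul_add_mul_quatDC lam F' (fun v => quatToM_injective lam (by
    change quatToM lam (F _) = quatToM lam (F _ * _)
    rw [quatToM_mul_quatX, hF, hF, quatToM_mul_quatX, map_smul]))
  exact ⟨p, q, fun v => by rw [← h, ← hF]; rfl⟩

/-! ### The quiver relations hold for the maps between R and M -/

theorem loops_anticomm (lam : ℂ) (m : M lam) :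
    loopA lam (loopB lam m) + loopB lam (loopA lam m) = 0 := by
  obtain ⟨v, rfl⟩ := quatToM_surjective lam m
  simp only [← quatToM_quatI_mul, ← quatToM_quatJ_mul, ← map_add]
  rw [← map_zero (quatToM lam)]
  congr 1
  ext1 <;> simp [quatI, quatJ]
  ring

theorem loopB_loopB_quatToM (lam : ℂ) (v : H lam) :
    loopB lam (loopB lam (quatToM lam v)) = quatToM lam (-tw • v) := by
  simp only [← quatToM_quatJ_mul]
  congr 1
  ext1 <;> simp [quatJ]

theorem loopA_loopA_quatToM (lam : ℂ) (v : H lam) :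
    loopA lam (loopA lam (quatToM lam v)) = quatToM lam (-tu lam • v) := by
  simp only [← quatToM_quatI_mul]
  congr 1
  ext1 <;> simp [quatI]

theorem loopB_loopB_mapD (lam : ℂ) (r : R lam) :
    loopB lam (loopB lam (mapD lam r)) + mapD lam (mapC lam (mapD lam r)) = 0 := by
  have hr : mapD lam r = r • quatToM lam 1 := by
    rw [← mapD_one, ← map_smul, smul_eq_mul, mul_one]
  rw [hr, map_smul, map_smul, map_smul, map_smul, ← smul_add, loopB_loopB_quatToM,
    mapD_mapC_quatToM, ← map_add, quatDC_eq]
  simp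

theorem mapC_loopB_loopB (lam : ℂ) (m : M lam) :
    mapC lam (loopB lam (loopB lam m)) + mapC lam (mapD lam (mapC lam m)) = 0 := by
  obtain ⟨v, rfl⟩ := quatToM_surjective lam m
  rw [loopB_loopB_quatToM, mapD_mapC_quatToM, ← map_add, ← map_add, mapC_quatToM, quatDC_eq]
  rw [show (0 : R lam) = incl lam 0 + incl lam 0 * toR lam x by simp]
  congr 2
  · simp [quatX]
    ring
  · congr 1
    simp [quatX]
    ring

theorem loopA_loopA_add (lam : ℂ) (m : M lam) :
    loopA lam (loopA lam m) + loopB lam (mapD lam (mapC lam m)) +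
      mapD lam (mapC lam (loopB lam m)) + lam • loopB lam (loopB lam m) +
      loopB lam (loopB lam (loopB lam m)) = 0 := by
  obtain ⟨v, rfl⟩ := quatToM_surjective lam m
  have hl (m : M lam) : lam • m = incl lam (C lam) • m := by
    rw [incl_C, algebraMap_smul]
  rw [hl, loopA_loopA_quatToM, mapD_mapC_quatToM, ← quatToM_quatJ_mul, ← quatToM_quatJ_mul,
    ← quatToM_quatJ_mul, ← quatToM_quatJ_mul, mapD_mapC_quatToM, ← quatToM_smul, ← map_add,
    ← map_add, ← map_add, ← map_add, ← map_zero (quatToM lam), quatDC_eq, quatDC_eq]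
  congr 1
  ext1 <;> simp [quatX, quatJ] <;> ring

end MorrisonPinkham

/-! ### The isomorphism -/

namespace MorrisonPinkham

open MvPolynomial

@[simp] theorem extRR_apply (lam : ℂ) (g : R lam →ₗ[R lam] R lam) (v : R lam × M lam) :
    extRR lam g v = (g v.1, 0) := rfl

@[simp] theorem extRM_apply (lam : ℂ) (g : R lam →ₗ[R lam] M lam) (v : R lam × M lam) :
    extRM lam g v = (0, g v.1) := rfl

@[simp] theorem extMR_apply (lam : ℂ) (g : M lam →ₗ[R lam] R lam) (v : R lam × M lam) :
    extMR lam g v = (g v.2, 0) := rfl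

@[simp] theorem extMM_apply (lam : ℂ) (g : M lam →ₗ[R lam] M lam) (v : R lam × M lam) :
    extMM lam g v = (0, g v.2) := rfl

/-- The images of the vertices in `End_R(R ⊕ M)`. -/
noncomputable def vertexEnd (lam : ℂ) : Vertex → EndRM lam
  | .nodeR => extRR lam LinearMap.id
  | .nodeM => extMM lam LinearMap.id

/-- The images of the arrows in `End_R(R ⊕ M)`. -/
noncomputable def arrowEnd (lam : ℂ) : {i j : Vertex} → (i ⟶ j) → EndRM lam
  | _, _, Arrow.d => extRM lam (mapD lam)
  | _, _, Arrow.c => extMR lam (mapC lam)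
  | _, _, Arrow.a => extMM lam (loopA lam)
  | _, _, Arrow.b => extMM lam (loopB lam)

theorem arrowEnd_mul_vertexEnd (lam : ℂ) {i j : Vertex} (α : i ⟶ j) :
    arrowEnd lam α * vertexEnd lam i = arrowEnd lam α := by
  change Arrow i j at α
  cases α <;> rfl

/-- The homomorphism from the path algebra to `End_R(R ⊕ M)`. -/
noncomputable def pathHom (lam : ℂ) : P →ₐ[ℂ] EndRM lam :=
  PathAlgebra.liftAlgHom (vertexEnd lam) (arrowEnd lam)
    (by rintro (_ | _) <;> rfl)
    (by
      rintro (_ | _) (_ | _) h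
      · exact absurd rfl h
      · exact LinearMap.ext fun v => by simp [vertexEnd]
      · exact LinearMap.ext fun v => by simp [vertexEnd]
      · exact absurd rfl h)
    (by
      change ∑ i ∈ {Vertex.nodeR, Vertex.nodeM}, vertexEnd lam i = 1
      rw [Finset.sum_pair (by simp)]
      exact LinearMap.ext fun v => by simp [vertexEnd])
    (by intro i j α; change Arrow i j at α; cases α <;> rfl)

theorem pathHom_eR (lam : ℂ) : pathHom lam eR = extRR lam LinearMap.id :=
  PathAlgebra.liftAlgHom_vertex _ _ _ _ _ _ _

theorem pathHom_eM (lam : ℂ) : pathHom lam eM = extMM lam LinearMap.id :=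
  PathAlgebra.liftAlgHom_vertex _ _ _ _ _ _ _

theorem pathHom_a (lam : ℂ) : pathHom lam a = extMM lam (loopA lam) :=
  PathAlgebra.liftAlgHom_arrow _ _ _ _ _ _ _ (arrowEnd_mul_vertexEnd lam _)

theorem pathHom_b (lam : ℂ) : pathHom lam b = extMM lam (loopB lam) :=
  PathAlgebra.liftAlgHom_arrow _ _ _ _ _ _ _ (arrowEnd_mul_vertexEnd lam _)

theorem pathHom_c (lam : ℂ) : pathHom lam c = extMR lam (mapC lam) :=
  PathAlgebra.liftAlgHom_arrow _ _ _ _ _ _ _ (arrowEnd_mul_vertexEnd lam _)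

theorem pathHom_d (lam : ℂ) : pathHom lam d = extRM lam (mapD lam) :=
  PathAlgebra.liftAlgHom_arrow _ _ _ _ _ _ _ (arrowEnd_mul_vertexEnd lam _)

theorem relIdeal_le_ker (lam : ℂ) : relIdeal lam ≤ TwoSidedIdeal.ker (pathHom lam) := by
  rw [relIdeal, TwoSidedIdeal.span_le]
  rintro p (rfl | rfl | rfl | rfl) <;>
    simp only [SetLike.mem_coe, TwoSidedIdeal.mem_ker, map_add, map_mul, map_smul,
      pathHom_a, pathHom_b, pathHom_c, pathHom_d, pow_succ, pow_zero, one_mul] <;>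
    refine LinearMap.ext fun v => Prod.ext ?_ ?_
  · simp
  · simpa using loopB_loopB_mapD lam v.1
  · simpa using mapC_loopB_loopB lam v.2
  · simp
  · simp
  · simpa using loops_anticomm lam v.2
  · simp
  · simpa using loopA_loopA_add lam v.2

/-- The homomorphism from the path algebra modulo the relations to `End_R(R ⊕ M)`. -/
noncomputable def quotHom (lam : ℂ) : A lam →ₐ[ℂ] EndRM lam :=
  RingCon.liftₐ (relIdeal lam).ringCon (pathHom lam) (by
    intro p q h
    have h' := relIdeal_le_ker lam ((TwoSidedIdeal.rel_iff _ _ _).mp h)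
    rw [TwoSidedIdeal.mem_ker, map_sub, sub_eq_zero] at h'
    exact h')

theorem quotHom_toA (lam : ℂ) (p : P) : quotHom lam (toA lam p) = pathHom lam p := rfl

theorem toA_mul (lam : ℂ) (p q : P) : toA lam (p * q) = toA lam p * toA lam q := rfl
theorem toA_add (lam : ℂ) (p q : P) : toA lam (p + q) = toA lam p + toA lam q := rfl
theorem toA_one (lam : ℂ) : toA lam 1 = 1 := rfl

theorem toA_eq_zero (lam : ℂ) {p : P} (h : p ∈ relIdeal lam) : toA lam p = 0 :=
  (RingCon.eq _).mpr h

/-- The classes of the vertices and arrows. -/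
noncomputable def generatorsA (lam : ℂ) : Generators lam (A lam) where
  eR := toA lam eR
  eM := toA lam eM
  a := toA lam a
  b := toA lam b
  c := toA lam c
  d := toA lam d
  add_eq_one := by
    rw [← toA_add, ← toA_one]
    congr 1
    change _ = ∑ i ∈ {Vertex.nodeR, Vertex.nodeM}, PathAlgebra.vertex ℂ i
    rw [Finset.sum_pair (by simp)]
    rfl
  a_eR := by rw [← toA_mul, a, eR, PathAlgebra.arrow, PathAlgebra.ofPath_mul_vertex]; rfl
  eR_a := by rw [← toA_mul, a, eR, PathAlgebra.arrow, PathAlgebra.vertex_mul_ofPath]; rfl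
  b_eR := by rw [← toA_mul, b, eR, PathAlgebra.arrow, PathAlgebra.ofPath_mul_vertex]; rfl
  eR_b := by rw [← toA_mul, b, eR, PathAlgebra.arrow, PathAlgebra.vertex_mul_ofPath]; rfl
  c_eR := by rw [← toA_mul, c, eR, PathAlgebra.arrow, PathAlgebra.ofPath_mul_vertex]; rfl
  eR_c := by rw [← toA_mul, c, eR, PathAlgebra.arrow, PathAlgebra.vertex_mul_ofPath]; rfl
  d_eR := by rw [← toA_mul, d, eR, PathAlgebra.arrow, PathAlgebra.ofPath_mul_vertex]; rfl
  eR_d := by rw [← toA_mul, d, eR, PathAlgebra.arrow, PathAlgebra.vertex_mul_ofPath]; rfl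
  relC := by
    have h := toA_eq_zero lam (TwoSidedIdeal.subset_span (Set.mem_insert _ _) :
      (b ^ 2 + d * c) * d ∈ relIdeal lam)
    rw [pow_two, add_mul] at h
    exact h
  relD := by
    have h := toA_eq_zero lam (TwoSidedIdeal.subset_span
      (Set.mem_insert_of_mem _ (Set.mem_insert _ _)) : c * (b ^ 2 + d * c) ∈ relIdeal lam)
    rw [pow_two, mul_add, ← mul_assoc, ← mul_assoc] at h
    exact h
  relA := toA_eq_zero lam (TwoSidedIdeal.subset_span
    (Set.mem_insert_of_mem _ (Set.mem_insert_of_mem _ (Set.mem_insert _ _))))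
  relB := by
    have h := toA_eq_zero lam (TwoSidedIdeal.subset_span
      (Set.mem_insert_of_mem _ (Set.mem_insert_of_mem _ (Set.mem_insert_of_mem _ rfl))) :
      a ^ 2 + b * d * c + d * c * b + lam • b ^ 2 + b ^ 3 ∈ relIdeal lam)
    rw [pow_three', pow_two, pow_two] at h
    rw [mul_assoc (algebraMap ℂ (A lam) lam), ← Algebra.smul_def]
    exact h
  span_eq_top := by
    intro V hR hM hV
    rw [eq_top_iff]
    rintro v -
    obtain ⟨p, rfl⟩ := RingCon.mk'_surjective _ v
    change toA lam p ∈ V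
    induction p using PathAlgebra.induction_arrows with
    | zero => exact V.zero_mem
    | add p q hp hq => exact V.add_mem hp hq
    | smul r p hp => exact V.smul_mem r hp
    | vertex i =>
      cases i
      · exact hR
      · exact hM
    | @arrow i j α p hp =>
      change Arrow i j at α
      cases α
      · exact (hV _ hp).2.2.2
      · exact (hV _ hp).2.2.1
      · exact (hV _ hp).1
      · exact (hV _ hp).2.1

noncomputable instance algebraTA (lam : ℂ) : Algebra T (A lam) := (generatorsA lam).algebra

/-- The generic element of `A`, with coefficients in `ℂ[z, w, y]`. -/
noncomputable abbrev normalFormA (lam : ℂ) (s t : T) (p q h k : H lam) : A lam :=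
  normalForm (toA lam eR) (toA lam eM) (toA lam a) (toA lam b) (toA lam c) (toA lam d) s t p q h k

/-! ### The map to End(R ⊕ M) on the central subalgebra and on normal forms -/

theorem quotHom_cW (lam : ℂ) :
    quotHom lam (generatorsA lam).cW = algebraMap (R lam) (EndRM lam) (toR lam w) := by
  change pathHom lam (c * d - b * b) = _
  simp only [map_sub, map_mul, pathHom_b, pathHom_c, pathHom_d]
  refine LinearMap.prod_ext (LinearMap.ext_ring ?_) (LinearMap.ext fun m => ?_)
  · simp [mapD_one, mapC_quatToM, Module.algebraMap_end_apply]
  · obtain ⟨v, rfl⟩ := quatToM_surjective lam m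
    simp [← quatToM_quatJ_mul, Module.algebraMap_end_apply, -Ideal.Quotient.mkₐ_eq_mk]
    rw [← incl_tw, ← quatToM_smul, ← map_neg]
    congr 1
    ext1 <;> simp [quatJ]

theorem quotHom_cY (lam : ℂ) :
    quotHom lam (generatorsA lam).cY = algebraMap (R lam) (EndRM lam) (toR lam y) := by
  change pathHom lam (c * b * d + b * d * c + d * c * b + b * b * b) = _
  simp only [map_add, map_mul, pathHom_b, pathHom_c, pathHom_d]
  refine LinearMap.prod_ext (LinearMap.ext_ring ?_) (LinearMap.ext fun m => ?_)
  · simp [mapD_one, ← quatToM_quatJ_mul, mapC_quatToM, Module.algebraMap_end_apply, quatJ]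
  · obtain ⟨v, rfl⟩ := quatToM_surjective lam m
    simp [← quatToM_quatJ_mul, mapD_mapC_quatToM, Module.algebraMap_end_apply,
      -Ideal.Quotient.mkₐ_eq_mk]
    rw [← incl_ty, ← quatToM_smul, ← map_add, ← map_add]
    congr 1
    rw [quatDC_eq, quatDC_eq]
    ext1 <;> simp [quatJ, quatX] <;> ring

theorem quotHom_cZ (lam : ℂ) :
    quotHom lam (generatorsA lam).cZ = algebraMap (R lam) (EndRM lam) (toR lam z) := by
  change pathHom lam (-(c * a * d + a * d * c + d * c * a + a * b * b)) = _
  simp only [map_neg, map_add, map_mul, pathHom_a, pathHom_b, pathHom_c, pathHom_d]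
  refine LinearMap.prod_ext (LinearMap.ext_ring ?_) (LinearMap.ext fun m => ?_)
  · simp [mapD_one, ← quatToM_quatI_mul, mapC_quatToM, Module.algebraMap_end_apply, quatI]
  · obtain ⟨v, rfl⟩ := quatToM_surjective lam m
    simp [← quatToM_quatJ_mul, ← quatToM_quatI_mul, mapD_mapC_quatToM,
      Module.algebraMap_end_apply, -Ideal.Quotient.mkₐ_eq_mk]
    rw [← incl_tz, ← quatToM_smul, ← map_neg, ← map_neg, ← map_neg, ← map_add, ← map_add]
    congr 1
    rw [quatDC_eq, quatDC_eq]
    ext1 <;> simp [quatI, quatJ, quatX] <;> ring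

/-- Both sides are ring homomorphisms in t, so constants and the three variables suffice. This makes
`quotHom` linear over `T`. -/
theorem quotHom_algebraMap (lam : ℂ) (t : T) :
    quotHom lam (algebraMap T (A lam) t) = algebraMap (R lam) (EndRM lam) (incl lam t) := by
  have h : (quotHom lam).toRingHom.comp (algebraMap T (A lam)) =
      (algebraMap (R lam) (EndRM lam)).comp (incl lam).toRingHom := by
    refine MvPolynomial.ringHom_ext (fun r => ?_) (fun i => ?_)
    · change quotHom lam (algebraMap T (A lam) (C r)) = algebraMap _ _ (incl lam (C r))
      rw [show algebraMap T (A lam) (C r) = algebraMap ℂ (A lam) r from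
        (generatorsA lam).algebraMap_C r, AlgHom.commutes, incl_C]
      exact LinearMap.ext fun v => by
        rw [Module.algebraMap_end_apply, Module.algebraMap_end_apply, algebraMap_smul]
    · fin_cases i
      · change quotHom lam (algebraMap T (A lam) tz) = algebraMap _ _ (incl lam tz)
        rw [incl_tz, ← quotHom_cZ]
        exact congrArg _ (generatorsA lam).algebraMap_X_zero
      · change quotHom lam (algebraMap T (A lam) tw) = algebraMap _ _ (incl lam tw)
        rw [incl_tw, ← quotHom_cW]
        exact congrArg _ (generatorsA lam).algebraMap_X_one
      · change quotHom lam (algebraMap T (A lam) ty) = algebraMap _ _ (incl lam ty)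
        rw [incl_ty, ← quotHom_cY]
        exact congrArg _ (generatorsA lam).algebraMap_X_two
  exact congrArg (fun g => g t) h

theorem quotHom_smul (lam : ℂ) (t : T) (v : A lam) :
    quotHom lam (t • v) = incl lam t • quotHom lam v := by
  rw [Algebra.smul_def, map_mul, quotHom_algebraMap]
  rfl

theorem quotHom_quatEval (lam : ℂ) (h : H lam) :
    quotHom lam (quatEval (toA lam eM) (toA lam a) (toA lam b) h) = extMM lam (quatEnd lam h) := by
  simp only [quatEval_apply, map_add, quotHom_smul, map_mul, quotHom_toA, pathHom_eM, pathHom_a,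
    pathHom_b]
  refine LinearMap.ext fun v => ?_
  simp [quatEnd]

/-- Evaluation at (1, 0) reads off s, t, p, and evaluation on M reads off q, h, k. The sign of t
arises because cabd acts on R as c(k) = -x. -/
theorem quotHom_normalFormA_inl (lam : ℂ) (s t : T) (p q h k : H lam) :
    quotHom lam (normalFormA lam s t p q h k) (1, 0) =
      (incl lam s + incl lam (-t) * toR lam x, quatToM lam p) := by
  simp only [normalForm, map_add, quotHom_smul, map_mul, quotHom_quatEval, quotHom_toA, pathHom_eR,
    pathHom_a, pathHom_b, pathHom_c, pathHom_d]
  simp [mapD_one, quatEnd_quatToM, ← quatToM_quatJ_mul, ← quatToM_quatI_mul, mapC_quatToM, quatI,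
    quatJ, -Ideal.Quotient.mkₐ_eq_mk]
  ring

theorem quotHom_normalFormA_inr (lam : ℂ) (s t : T) (p q h k v : H lam) :
    quotHom lam (normalFormA lam s t p q h k) (0, quatToM lam v) =
      (mapC lam (quatToM lam (q * v)), quatToM lam (h * v + k * quatDC lam v)) := by
  simp only [normalForm, map_add, quotHom_smul, map_mul, quotHom_quatEval, quotHom_toA, pathHom_eR,
    pathHom_a, pathHom_b, pathHom_c, pathHom_d]
  simp [quatEnd_quatToM, mapD_mapC_quatToM]

theorem quotHom_injective (lam : ℂ) : Function.Injective (quotHom lam) := by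
  rw [injective_iff_map_eq_zero]
  intro v hv
  obtain ⟨s, t, p, q, h, k, rfl⟩ := (generatorsA lam).exists_eq_normalForm v
  change quotHom lam (normalFormA lam s t p q h k) = 0 at hv
  change normalFormA lam s t p q h k = 0
  have h₁ := quotHom_normalFormA_inl lam s t p q h k
  have h₂ := quotHom_normalFormA_inr lam s t p q h k
  rw [hv] at h₁ h₂
  have hst : s = 0 ∧ -t = 0 := coords_unique lam (by
    rw [map_zero, zero_mul, add_zero]
    exact (congrArg Prod.fst h₁).symm)
  have hp : p = 0 := quatToM_injective lam (by
    rw [map_zero]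
    exact (congrArg Prod.snd h₁).symm)
  have hq : q = 0 := mapC_quatToM_eq_zero lam q fun v => (congrArg Prod.fst (h₂ v)).symm
  obtain ⟨rfl, rfl⟩ := eq_zero_of_mul_add_mul_quatDC lam h k fun v => quatToM_injective lam (by
    rw [map_zero]
    exact (congrArg Prod.snd (h₂ v)).symm)
  rw [hst.1, neg_eq_zero.mp hst.2, hp, hq]
  simp [normalForm]

/-- The four blocks of g are classified separately, and their coordinates are used as the
coefficients of a normal form. -/
theorem quotHom_surjective (lam : ℂ) : Function.Surjective (quotHom lam) := by
  intro g
  obtain ⟨s, t, hst⟩ := exists_coords lam (g (1, 0)).1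
  obtain ⟨p, hp⟩ := quatToM_surjective lam (g (1, 0)).2
  obtain ⟨q, hq⟩ := exists_eq_mapC_mul lam
    (LinearMap.fst _ _ _ ∘ₗ g ∘ₗ LinearMap.inr (R lam) (R lam) (M lam))
  obtain ⟨h, k, hhk⟩ := exists_eq_quatEnd_add lam
    (LinearMap.snd _ _ _ ∘ₗ g ∘ₗ LinearMap.inr (R lam) (R lam) (M lam))
  refine ⟨normalFormA lam s (-t) p q h k,
    LinearMap.prod_ext (LinearMap.ext_ring ?_) (LinearMap.ext fun m => ?_)⟩
  · change quotHom lam _ (1, 0) = g (1, 0)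
    rw [quotHom_normalFormA_inl, neg_neg, ← hst, hp]
  · obtain ⟨v, rfl⟩ := quatToM_surjective lam m
    change quotHom lam _ (0, quatToM lam v) = g (0, quatToM lam v)
    rw [quotHom_normalFormA_inr, ← hq, ← hhk]
    rfl

end MorrisonPinkham

open MorrisonPinkham in
theorem theorem2 (lam : ℂ) :
    (Phi lam * Psi lam = f lam • (1 : Matrix (Fin 4) (Fin 4) S) ∧
      Psi lam * Phi lam = f lam • (1 : Matrix (Fin 4) (Fin 4) S)) ∧
    (PathAlgebra.cycDeriv ℂ arrC (W lam) = (b ^ 2 + d * c) * d ∧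
      PathAlgebra.cycDeriv ℂ arrD (W lam) = c * (b ^ 2 + d * c) ∧
      PathAlgebra.cycDeriv ℂ arrA (W lam) = a * b + b * a ∧
      PathAlgebra.cycDeriv ℂ arrB (W lam) =
        a ^ 2 + b * d * c + d * c * b + lam • b ^ 2 + b ^ 3) ∧
    ∃ Θ : A lam ≃ₐ[ℂ] EndRM lam,
      Θ (toA lam eR) = extRR lam LinearMap.id ∧
      Θ (toA lam eM) = extMM lam LinearMap.id ∧
      Θ (toA lam a) = extMM lam (loopA lam) ∧
      Θ (toA lam b) = extMM lam (loopB lam) ∧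
      Θ (toA lam c) = extMR lam (mapC lam) ∧
      Θ (toA lam d) = extRM lam (mapD lam) :=
  ⟨⟨Phi_mul_Psi lam, Psi_mul_Phi lam⟩, cycDeriv_W lam,
    AlgEquiv.ofBijective (quotHom lam) ⟨quotHom_injective lam, quotHom_surjective lam⟩,
    pathHom_eR lam, pathHom_eM lam, pathHom_a lam, pathHom_b lam, pathHom_c lam, pathHom_d lam⟩
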